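/- Let $\gamma_3(E)=[[E,E],E]$ and $E'=[E,E]$ for a group $E$; for $N\trianglelefteq E$ let $\mathfrak e$ and $\mathfrak n$ be the augmentation ideals of $\mathbb Z[E]$ and $\mathbb Z[N]$, and let $D_3(E,N)=E\cap(1+\mathfrak n\mathfrak e+\mathfrak e^3)$, a subgroup of $E$ that contains $N'\gamma_3(E)$. For abelian groups $A,C$ let $\mathrm{Tor}(A,C)$ be the abelian group generated by symbols $\tau_m(a,c)$ ($a\in A$, $c\in C$, $m\ge 1$, $ma=mc=0$) with relations, whenever all the symbols that occur are defined, $\tau_m(a_1+a_2,c)=\tau_m(a_1,c)+\tau_m(a_2,c)$, $\tau_m(a,c_1+c_2)=\tau_m(a,c_1)+\tau_m(a,c_2)$, $\tau_{mn}(a,c)=\tau_m(na,c)$ and $\tau_{mn}(a,c)=\tau_m(a,nc)$. The exterior torsion square $A\wedge^{*}A$ is the quotient of $\mathrm{Tor}(A,A)$ by the subgroup generated by all $\tau_m(x,x)$ with $x\in A$, $m\ge1$, $mx=0$. It is functorial in $A$. For $N\trianglelefteq E$ put $A=E/NE'$. Let $\omega_1:\mathrm{Tor}(A,A)\to (NE'/E')\otimes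 A$ be the connecting homomorphism of the short exact sequence $0\to NE'/E'\xrightarrow{i} E/E'\xrightarrow{q} A\to 0$, that is, $\omega_1\tau_m(x,y)=i^{-1}(mx')\otimes y$ for any $x'$ with $q(x')=x$. Let $[\,,\,]:(NE'/E')\otimes A\to N\gamma_3(E)/N'\gamma_3(E)$ be the commutation homomorphism $xE'\otimes b\,NE'\mapsto [x,b]\,N'\gamma_3(E)$. **Theorem.** Let $F$ be a free group and $R$ a normal subgroup of $F$. Then the composite $[\,,\,]\,\omega_1$ (formed for $E=F$, $N=R$) induces an isomorphism $$\Phi_{F,R}:\ (F/RF')\wedge^{*}(F/RF')\ \xrightarrow{\ \cong\ }\ D_3(F,R)/R'\gamma_3(F),$$ that is, for each $t\in\mathrm{Tor}(F/RF',F/RF')$ the image of the class of $t$ under $\Phi_{F,R}$ and the element $[\,,\,]\,\omega_1(t)$ coincide in $F/R'\gamma_3(F)$. This isomorphism is natural: if $F_1,F_2$ are free groups with normal subgroups $R_1,R_2$ and $\varphi:F_1\to F_2$ is a homomorphism with $\varphi(R_1)\subseteq R_2F_2'$ (in particular, if $\varphi(R_1)\subseteq R_2$), then $\varphi$ induces homomorphisms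 $F_1/R_1F_1'\to F_2/R_2F_2'$ and $D_3(F_1,R_1)/R_1'\gamma_3(F_1)\to D_3(F_2,R_2)/R_2'\gamma_3(F_2)$, and $\Phi_{F_1,R_1}$, $\Phi_{F_2,R_2}$ commute with the maps induced by them. -/

import Mathlib

open scoped TensorProduct commutatorElement

universe u

/-! ### The torsion product and the exterior torsion square of abelian groups -/

/-- The symbols `(a, m, c)` with `a ∈ A`, `c ∈ C`, `m > 0` and `m a = m c = 0`. -/
structure TorSymbol (A C : Type*) [AddCommGroup A] [AddCommGroup C] where
  a : A
  m : ℕ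
  c : C
  pos : 0 < m
  ha : m • a = 0
  hc : m • c = 0

section TorsionProduct

variable {A B C D : Type*} [AddCommGroup A] [AddCommGroup B] [AddCommGroup C] [AddCommGroup D]

/-- The defining relators of `Tor(A, C)`. The hypotheses on the arguments only say that the
symbols which occur in the relator are defined. -/
inductive TorRelator : FreeAbelianGroup (TorSymbol A C) → Prop
  | add_left (a₁ a₂ : A) (m : ℕ) (c : C) (hm : 0 < m) (h₁ : m • a₁ = 0) (h₂ : m • a₂ = 0)
      (h : m • (a₁ + a₂) = 0) (hc : m • c = 0) :
      TorRelator (FreeAbelianGroup.of ⟨a₁ + a₂, m, c, hm, h, hc⟩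
        - (FreeAbelianGroup.of ⟨a₁, m, c, hm, h₁, hc⟩
          + FreeAbelianGroup.of ⟨a₂, m, c, hm, h₂, hc⟩))
  | add_right (a : A) (m : ℕ) (c₁ c₂ : C) (hm : 0 < m) (ha : m • a = 0) (h₁ : m • c₁ = 0)
      (h₂ : m • c₂ = 0) (h : m • (c₁ + c₂) = 0) :
      TorRelator (FreeAbelianGroup.of ⟨a, m, c₁ + c₂, hm, ha, h⟩
        - (FreeAbelianGroup.of ⟨a, m, c₁, hm, ha, h₁⟩
          + FreeAbelianGroup.of ⟨a, m, c₂, hm, ha, h₂⟩))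
  | mul_left (a : A) (m n : ℕ) (c : C) (hmn : 0 < m * n) (hm : 0 < m) (ha : (m * n) • a = 0)
      (hc' : (m * n) • c = 0) (ha' : m • (n • a) = 0) (hc : m • c = 0) :
      TorRelator (FreeAbelianGroup.of ⟨a, m * n, c, hmn, ha, hc'⟩
        - FreeAbelianGroup.of ⟨n • a, m, c, hm, ha', hc⟩)
  | mul_right (a : A) (m n : ℕ) (c : C) (hmn : 0 < m * n) (hm : 0 < m) (ha' : (m * n) • a = 0)
      (hc : (m * n) • c = 0) (ha : m • a = 0) (hc' : m • (n • c) = 0) :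
      TorRelator (FreeAbelianGroup.of ⟨a, m * n, c, hmn, ha', hc⟩
        - FreeAbelianGroup.of ⟨a, m, n • c, hm, ha, hc'⟩)

variable (A C) in
/-- `Tor(A, C)`, by generators `(a, m, c)` and relations. -/
abbrev TorsionProduct : Type _ :=
  FreeAbelianGroup (TorSymbol A C) ⧸
    AddSubgroup.closure {r : FreeAbelianGroup (TorSymbol A C) | TorRelator r}

/-- The class `τ_m(a, c)` of the symbol `(a, m, c)`. -/
def torTau (a : A) (m : ℕ) (c : C) (hm : 0 < m) (ha : m • a = 0) (hc : m • c = 0) :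
    TorsionProduct A C :=
  QuotientAddGroup.mk (FreeAbelianGroup.of ⟨a, m, c, hm, ha, hc⟩)

/-- A function on symbols that respects the defining relations extends to `Tor(A, C)`. -/
def TorsionProduct.lift (f : TorSymbol A C → B)
    (hf : ∀ r, TorRelator r → FreeAbelianGroup.lift f r = 0) : TorsionProduct A C →+ B :=
  QuotientAddGroup.lift _ (FreeAbelianGroup.lift f)
    ((AddSubgroup.closure_le (FreeAbelianGroup.lift f).ker).2 fun r hr => hf r hr)

theorem TorsionProduct.lift_tau (f : TorSymbol A C → B)
    (hf : ∀ r, TorRelator r → FreeAbelianGroup.lift f r = 0)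
    (a : A) (m : ℕ) (c : C) (hm : 0 < m) (ha : m • a = 0) (hc : m • c = 0) :
    TorsionProduct.lift f hf (torTau a m c hm ha hc) = f ⟨a, m, c, hm, ha, hc⟩ := by
  exact FreeAbelianGroup.lift_apply_of _ _

theorem torTau_relator {r : FreeAbelianGroup (TorSymbol A C)} (hr : TorRelator r) :
    (QuotientAddGroup.mk r : TorsionProduct A C) = 0 :=
  (QuotientAddGroup.eq_zero_iff r).2 (AddSubgroup.subset_closure hr)

/-- The map `Tor(A, B) → Tor(C, D)` with `τ_m(a, b) ↦ τ_m(f a, g b)`. -/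
def TorsionProduct.map (f : A →+ C) (g : B →+ D) : TorsionProduct A B →+ TorsionProduct C D :=
  TorsionProduct.lift
    (fun s => torTau (f s.a) s.m (g s.c) s.pos (by rw [← map_nsmul, s.ha, map_zero])
      (by rw [← map_nsmul, s.hc, map_zero])) (by
    intro r hr
    cases hr with
    | add_left a₁ a₂ m c hm h₁ h₂ h hc =>
      simp only [map_sub, map_add, FreeAbelianGroup.lift_apply_of]
      exact torTau_relator (TorRelator.add_left (f a₁) (f a₂) m (g c) hm _ _
        (by rw [← map_add, ← map_nsmul, h, map_zero]) _)
    | add_right a m c₁ c₂ hm ha h₁ h₂ h =>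
      simp only [map_sub, map_add, FreeAbelianGroup.lift_apply_of]
      exact torTau_relator (TorRelator.add_right (f a) m (g c₁) (g c₂) hm _ _ _
        (by rw [← map_add, ← map_nsmul, h, map_zero]))
    | mul_left a m n c hmn hm ha hc' ha' hc =>
      simp only [map_sub, map_nsmul, FreeAbelianGroup.lift_apply_of]
      exact torTau_relator (TorRelator.mul_left (f a) m n (g c) hmn hm _ _
        (by rw [← map_nsmul, ← map_nsmul, ha', map_zero]) _)
    | mul_right a m n c hmn hm ha' hc ha hc' =>
      simp only [map_sub, map_nsmul, FreeAbelianGroup.lift_apply_of]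
      exact torTau_relator (TorRelator.mul_right (f a) m n (g c) hmn hm _ _ _
        (by rw [← map_nsmul, ← map_nsmul, hc', map_zero])))

theorem TorsionProduct.map_tau (f : A →+ C) (g : B →+ D)
    (a : A) (m : ℕ) (b : B) (hm : 0 < m) (ha : m • a = 0) (hb : m • b = 0) :
    TorsionProduct.map f g (torTau a m b hm ha hb) =
      torTau (f a) m (g b) hm (by rw [← map_nsmul, ha, map_zero])
        (by rw [← map_nsmul, hb, map_zero]) :=
  TorsionProduct.lift_tau _ _ _ _ _ _ _ _

variable (A) in
/-- The subgroup of `Tor(A, A)` generated by the elements `τ_m(x, x)`. -/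
def torDiagonal : AddSubgroup (TorsionProduct A A) :=
  AddSubgroup.closure
    {t | ∃ (x : A) (m : ℕ) (hm : 0 < m) (hx : m • x = 0), t = torTau x m x hm hx hx}

variable (A) in
/-- The exterior torsion square of `A`: `Tor(A, A)` modulo the elements `τ_m(x, x)`. -/
abbrev ExtTorSquare : Type _ := TorsionProduct A A ⧸ torDiagonal A

/-- The functoriality of the exterior torsion square, `[τ_m(x, y)] ↦ [τ_m(f x, f y)]`. -/
def ExtTorSquare.map (f : A →+ C) : ExtTorSquare A →+ ExtTorSquare C :=
  QuotientAddGroup.map (torDiagonal A) (torDiagonal C) (TorsionProduct.map f f) (by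
    refine (AddSubgroup.closure_le _).2 ?_
    rintro _ ⟨x, m, hm, hx, rfl⟩
    refine AddSubgroup.subset_closure
      ⟨f x, m, hm, by rw [← map_nsmul, hx, map_zero], ?_⟩
    exact TorsionProduct.map_tau _ _ _ _ _ _ _ _)

/-- For a short exact sequence `0 → C → D → A → 0` of abelian groups and an element `a` of `A`
with `m a = 0`: the element `i⁻¹(m a')` of `C`, for a chosen `a' ∈ D` with `q a' = a`. -/
noncomputable def connectingElement (i : C →+ D) (q : D →+ A) (hex : Function.Exact i q)
    (hq : Function.Surjective q) (a : A) (m : ℕ) (ha : m • a = 0) : C :=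
  ((hex (m • (hq a).choose)).1 (by rw [map_nsmul, (hq a).choose_spec, ha])).choose

theorem connectingElement_spec (i : C →+ D) (q : D →+ A) (hex : Function.Exact i q)
    (hq : Function.Surjective q) (a : A) (m : ℕ) (ha : m • a = 0) :
    i (connectingElement i q hex hq a m ha) = m • (hq a).choose :=
  ((hex (m • (hq a).choose)).1 (by rw [map_nsmul, (hq a).choose_spec, ha])).choose_spec

/-- The choice of `a'` does not matter after tensoring with an element killed by `m`. -/
theorem connectingElement_tmul (i : C →+ D) (q : D →+ A) (hi : Function.Injective i)
    (hex : Function.Exact i q) (hq : Function.Surjective q) (a : A) (m : ℕ) (ha : m • a = 0)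
    (b : B) (hb : m • b = 0) (d : D) (hd : q d = a) (x : C) (hx : i x = m • d) :
    connectingElement i q hex hq a m ha ⊗ₜ[ℤ] b = x ⊗ₜ[ℤ] b := by
  obtain ⟨e, he⟩ := (hex (d - (hq a).choose)).1 (by
    rw [map_sub, hd, (hq a).choose_spec, sub_self])
  have h : x = connectingElement i q hex hq a m ha + m • e := by
    apply hi
    rw [map_add, connectingElement_spec, map_nsmul, he, hx, nsmul_sub]
    abel
  rw [h, TensorProduct.add_tmul, TensorProduct.smul_tmul, hb, TensorProduct.tmul_zero, add_zero]

/-- The connecting homomorphism `ω₁ : Tor(A, B) → C ⊗ B` of the six-term exact sequence of a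
short exact sequence `0 → C → D → A → 0`: `τ_m(a, b) ↦ i⁻¹(m a') ⊗ b`, where `q a' = a`. -/
noncomputable def torConnecting (i : C →+ D) (q : D →+ A) (hi : Function.Injective i)
    (hex : Function.Exact i q) (hq : Function.Surjective q) : TorsionProduct A B →+ C ⊗[ℤ] B :=
  TorsionProduct.lift (fun s => connectingElement i q hex hq s.a s.m s.ha ⊗ₜ[ℤ] s.c) (by
    intro r hr
    cases hr with
    | add_left a₁ a₂ m c hm h₁ h₂ h hc =>
      simp only [map_sub, map_add, FreeAbelianGroup.lift_apply_of]
      rw [sub_eq_zero, ← TensorProduct.add_tmul]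
      refine connectingElement_tmul i q hi hex hq _ _ _ _ hc
        ((hq a₁).choose + (hq a₂).choose) ?_ _ ?_
      · rw [map_add, (hq a₁).choose_spec, (hq a₂).choose_spec]
      · rw [map_add, connectingElement_spec, connectingElement_spec, nsmul_add]
    | add_right a m c₁ c₂ hm ha h₁ h₂ h =>
      simp only [map_sub, map_add, FreeAbelianGroup.lift_apply_of]
      rw [sub_eq_zero, ← TensorProduct.tmul_add]
    | mul_left a m n c hmn hm ha hc' ha' hc =>
      simp only [map_sub, FreeAbelianGroup.lift_apply_of]
      rw [sub_eq_zero]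
      symm
      refine connectingElement_tmul i q hi hex hq _ _ _ _ hc (n • (hq a).choose) ?_ _ ?_
      · rw [map_nsmul, (hq a).choose_spec]
      · rw [connectingElement_spec, mul_nsmul']
    | mul_right a m n c hmn hm ha' hc ha hc' =>
      simp only [map_sub, FreeAbelianGroup.lift_apply_of]
      rw [sub_eq_zero, ← TensorProduct.smul_tmul]
      refine connectingElement_tmul i q hi hex hq _ _ _ _ hc (hq a).choose
        (hq a).choose_spec _ ?_
      rw [map_nsmul, connectingElement_spec, ← mul_nsmul])

theorem torConnecting_tau (i : C →+ D) (q : D →+ A) (hi : Function.Injective i)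
    (hex : Function.Exact i q) (hq : Function.Surjective q)
    (a : A) (m : ℕ) (b : B) (hm : 0 < m) (ha : m • a = 0) (hb : m • b = 0)
    (d : D) (hd : q d = a) (x : C) (hx : i x = m • d) :
    torConnecting i q hi hex hq (torTau a m b hm ha hb) = x ⊗ₜ[ℤ] b :=
  (TorsionProduct.lift_tau _ _ _ _ _ _ _ _).trans
    (connectingElement_tmul i q hi hex hq a m ha b hb d hd x hx)

end TorsionProduct

/-! ### Relative dimension subgroups -/

section RelativeDimension

variable {E : Type*} [Group E]

variable (E) in
/-- The augmentation ideal `𝔢` of the integral group ring `ℤ[E]`. -/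
noncomputable def augIdeal : Ideal (MonoidAlgebra ℤ E) :=
  RingHom.ker (MonoidAlgebra.lift ℤ ℤ E (1 : E →* ℤ)).toRingHom

instance : (augIdeal E).IsTwoSided := by unfold augIdeal; infer_instance

/-- The left ideal `ℤ[E] 𝔫` of `ℤ[E]` generated by the augmentation ideal `𝔫` of `N`, that is, by
the elements `n - 1` with `n ∈ N`. For normal `N` it satisfies `ℤ[E] 𝔫 = 𝔫 ℤ[E]`, so that
`(ℤ[E] 𝔫) 𝔢 = 𝔫 𝔢`. -/
noncomputable def subAugIdeal (N : Subgroup E) : Ideal (MonoidAlgebra ℤ E) :=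
  Ideal.span {x | ∃ n ∈ N, x = MonoidAlgebra.of ℤ E n - 1}

/-- The ideal `𝔫 𝔢 + 𝔢 ^ n` of `ℤ[E]`. -/
noncomputable def relDimIdeal (N : Subgroup E) (n : ℕ) : Ideal (MonoidAlgebra ℤ E) :=
  subAugIdeal N * augIdeal E ⊔ augIdeal E ^ n

instance (N : Subgroup E) (n : ℕ) : (relDimIdeal N n).IsTwoSided where
  mul_mem_of_left {x} y hx := by
    obtain ⟨a, ha, b, hb, rfl⟩ := Submodule.mem_sup.1 hx
    rw [add_mul]
    exact add_mem (Ideal.mem_sup_left (Ideal.mul_mem_right y _ ha))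
      (Ideal.mem_sup_right (Ideal.mul_mem_right y _ hb))

/-- The subgroup `E ∩ (1 + I)` of `E`, for a two-sided ideal `I` of `ℤ[E]`. -/
noncomputable def congruenceSubgroup (I : Ideal (MonoidAlgebra ℤ E)) [I.IsTwoSided] : Subgroup E where
  carrier := {x | MonoidAlgebra.of ℤ E x - 1 ∈ I}
  one_mem' := by
    rw [Set.mem_ofPred_eq, map_one, sub_self]
    exact zero_mem _
  mul_mem' := by
    intro x y hx hy
    have h : MonoidAlgebra.of ℤ E (x * y) - 1 =
        (MonoidAlgebra.of ℤ E x - 1) * MonoidAlgebra.of ℤ E y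
          + (MonoidAlgebra.of ℤ E y - 1) := by
      rw [map_mul]; noncomm_ring
    rw [Set.mem_ofPred_eq, h]
    exact add_mem (Ideal.mul_mem_right _ _ hx) hy
  inv_mem' := by
    intro x hx
    have h : MonoidAlgebra.of ℤ E x⁻¹ - 1 =
        -(MonoidAlgebra.of ℤ E x⁻¹ * (MonoidAlgebra.of ℤ E x - 1)) := by
      rw [mul_sub, ← map_mul, inv_mul_cancel, map_one, mul_one, neg_sub]
    rw [Set.mem_ofPred_eq, h]
    exact neg_mem (Ideal.mul_mem_left _ _ hx)

theorem mem_congruenceSubgroup {I : Ideal (MonoidAlgebra ℤ E)} [I.IsTwoSided] {x : E} :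
    x ∈ congruenceSubgroup I ↔ MonoidAlgebra.of ℤ E x - 1 ∈ I := Iff.rfl

/-- The `n`-th dimension subgroup of `E` relative to `N`,
`D_n(E, N) = E ∩ (1 + 𝔫 𝔢 + 𝔢 ^ n)`. -/
noncomputable def relDimSubgroup (N : Subgroup E) (n : ℕ) : Subgroup E :=
  congruenceSubgroup (relDimIdeal N n)

theorem of_sub_one_mem_augIdeal (x : E) : MonoidAlgebra.of ℤ E x - 1 ∈ augIdeal E := by
  simp [augIdeal, RingHom.mem_ker]

theorem of_sub_one_mem_subAugIdeal {N : Subgroup E} {x : E} (hx : x ∈ N) :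
    MonoidAlgebra.of ℤ E x - 1 ∈ subAugIdeal N :=
  Ideal.subset_span ⟨x, hx, rfl⟩

theorem of_commutator_sub_one (x y : E) : MonoidAlgebra.of ℤ E ⁅x, y⁆ - 1 =
    ((MonoidAlgebra.of ℤ E x - 1) * (MonoidAlgebra.of ℤ E y - 1)
      - (MonoidAlgebra.of ℤ E y - 1) * (MonoidAlgebra.of ℤ E x - 1))
        * MonoidAlgebra.of ℤ E (x⁻¹ * y⁻¹) := by
  have h : (MonoidAlgebra.of ℤ E x - 1) * (MonoidAlgebra.of ℤ E y - 1)
      - (MonoidAlgebra.of ℤ E y - 1) * (MonoidAlgebra.of ℤ E x - 1)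
      = MonoidAlgebra.of ℤ E (x * y) - MonoidAlgebra.of ℤ E (y * x) := by
    rw [map_mul, map_mul]; noncomm_ring
  have h1 : x * y * (x⁻¹ * y⁻¹) = ⁅x, y⁆ := by simp [commutatorElement_def, mul_assoc]
  have h2 : y * x * (x⁻¹ * y⁻¹) = 1 := by group
  rw [h, sub_mul, ← map_mul, ← map_mul, h1, h2, map_one]

theorem commutator_le_congruenceSubgroup :
    commutator E ≤ congruenceSubgroup (augIdeal E ^ 2) := by
  refine Subgroup.commutator_le.2 fun x _ y _ => ?_
  rw [mem_congruenceSubgroup, of_commutator_sub_one]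
  refine Ideal.mul_mem_right _ _ (sub_mem ?_ ?_) <;>
  · rw [Submodule.pow_succ, Submodule.pow_one]
    exact Ideal.mul_mem_mul (of_sub_one_mem_augIdeal _) (of_sub_one_mem_augIdeal _)

theorem lowerCentralSeries_two_le_congruenceSubgroup :
    (⊤ : Subgroup E).lowerCentralSeries 2 ≤ congruenceSubgroup (augIdeal E ^ 3) := by
  refine Subgroup.commutator_le.2 fun x hx y _ => ?_
  rw [Subgroup.top_lowerCentralSeries_one] at hx
  have hx' : MonoidAlgebra.of ℤ E x - 1 ∈ augIdeal E ^ 2 := commutator_le_congruenceSubgroup hx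
  rw [mem_congruenceSubgroup, of_commutator_sub_one]
  refine Ideal.mul_mem_right _ _ (sub_mem ?_ ?_)
  · rw [Submodule.pow_succ]
    exact Ideal.mul_mem_mul hx' (of_sub_one_mem_augIdeal _)
  · rw [Ideal.IsTwoSided.pow_succ]
    exact Ideal.mul_mem_mul (of_sub_one_mem_augIdeal _) hx'

/-- `N' γ₃(E) ⊆ D₃(E, N)`. -/
theorem relGammaThree_le_relDimSubgroup (N : Subgroup E) :
    ⁅N, N⁆ ⊔ (⊤ : Subgroup E).lowerCentralSeries 2 ≤ relDimSubgroup N 3 := by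
  refine sup_le (Subgroup.commutator_le.2 fun x hx y hy => ?_) ?_
  · rw [relDimSubgroup, mem_congruenceSubgroup, of_commutator_sub_one]
    refine Ideal.mem_sup_left (Ideal.mul_mem_right _ _ (sub_mem ?_ ?_))
    · exact Ideal.mul_mem_mul (of_sub_one_mem_subAugIdeal hx) (of_sub_one_mem_augIdeal _)
    · exact Ideal.mul_mem_mul (of_sub_one_mem_subAugIdeal hy) (of_sub_one_mem_augIdeal _)
  · exact fun x hx => Ideal.mem_sup_right (lowerCentralSeries_two_le_congruenceSubgroup hx)

theorem augIdeal_le_comap {E₂ : Type*} [Group E₂] (φ : E →* E₂) :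
    augIdeal E ≤ (augIdeal E₂).comap (MonoidAlgebra.mapDomainRingHom ℤ φ) := by
  have h : (MonoidAlgebra.lift ℤ ℤ E₂ (1 : E₂ →* ℤ)).toRingHom.comp
      (MonoidAlgebra.mapDomainRingHom ℤ φ)
        = (MonoidAlgebra.lift ℤ ℤ E (1 : E →* ℤ)).toRingHom := by
    ext x <;> simp
  intro x hx
  have hx' := RingHom.congr_fun h x
  exact hx'.trans hx

theorem subAugIdeal_le_comap {E₂ : Type*} [Group E₂] (N : Subgroup E) (N₂ : Subgroup E₂)
    (φ : E →* E₂) (h : N ≤ (N₂ ⊔ commutator E₂).comap φ) :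
    subAugIdeal N ≤
      (subAugIdeal N₂ ⊔ augIdeal E₂ ^ 2).comap (MonoidAlgebra.mapDomainRingHom ℤ φ) := by
  refine Ideal.span_le.2 ?_
  rintro _ ⟨n, hn, rfl⟩
  obtain ⟨n₂, hn₂, e, he, hne⟩ := Subgroup.mem_sup_of_normal_right.1 (h hn)
  have he' : MonoidAlgebra.of ℤ E₂ e - 1 ∈ augIdeal E₂ ^ 2 :=
    commutator_le_congruenceSubgroup he
  have h1 : MonoidAlgebra.mapDomainRingHom ℤ φ (MonoidAlgebra.of ℤ E n - 1)
      = (MonoidAlgebra.of ℤ E₂ n₂ - 1)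
        + MonoidAlgebra.of ℤ E₂ n₂ * (MonoidAlgebra.of ℤ E₂ e - 1) := by
    have h2 : MonoidAlgebra.mapDomainRingHom ℤ φ (MonoidAlgebra.of ℤ E n)
        = MonoidAlgebra.of ℤ E₂ (φ n) := by simp
    rw [map_sub, map_one, h2, ← hne, map_mul]
    noncomm_ring
  change MonoidAlgebra.mapDomainRingHom ℤ φ (MonoidAlgebra.of ℤ E n - 1)
    ∈ subAugIdeal N₂ ⊔ augIdeal E₂ ^ 2
  rw [h1]
  exact add_mem (Ideal.mem_sup_left (of_sub_one_mem_subAugIdeal hn₂))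
    (Ideal.mem_sup_right (Ideal.mul_mem_left _ _ he'))

theorem ideal_mul_le_comap {S T : Type*} [Ring S] [Ring T] (f : S →+* T) {I J : Ideal S}
    {I₂ J₂ : Ideal T} (hI : I ≤ I₂.comap f) (hJ : J ≤ J₂.comap f) :
    I * J ≤ (I₂ * J₂).comap f := by
  refine Ideal.mul_le.2 fun r hr t ht => ?_
  rw [Ideal.mem_comap, map_mul]
  exact Ideal.mul_mem_mul (hI hr) (hJ ht)

/-- A homomorphism with `φ(N) ⊆ N₂ E₂'` maps `D₃(E, N)` into `D₃(E₂, N₂)`. -/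
theorem relDimSubgroup_three_le_comap {E₂ : Type*} [Group E₂] (N : Subgroup E)
    (N₂ : Subgroup E₂) (φ : E →* E₂) (h : N ≤ (N₂ ⊔ commutator E₂).comap φ) :
    relDimSubgroup N 3 ≤ (relDimSubgroup N₂ 3).comap φ := by
  have hmul := ideal_mul_le_comap (MonoidAlgebra.mapDomainRingHom ℤ φ)
    (subAugIdeal_le_comap N N₂ φ h) (augIdeal_le_comap φ)
  have hpow : augIdeal E ^ 3 ≤
      (augIdeal E₂ ^ 3).comap (MonoidAlgebra.mapDomainRingHom ℤ φ) := by
    have h1 := ideal_mul_le_comap (MonoidAlgebra.mapDomainRingHom ℤ φ)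
      (augIdeal_le_comap φ) (augIdeal_le_comap φ)
    have h2 := ideal_mul_le_comap (MonoidAlgebra.mapDomainRingHom ℤ φ) h1 (augIdeal_le_comap φ)
    simpa only [Submodule.pow_succ (n := 2), Submodule.pow_succ (n := 1), Submodule.pow_one]
      using h2
  have hle : relDimIdeal N 3 ≤
      (relDimIdeal N₂ 3).comap (MonoidAlgebra.mapDomainRingHom ℤ φ) := by
    refine sup_le (hmul.trans (Ideal.comap_mono ?_)) (hpow.trans (Ideal.comap_mono le_sup_right))
    rw [Ideal.sup_mul, ← Submodule.pow_succ]
    exact le_rfl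
  intro x hx
  have hx' := hle hx
  have h2 : MonoidAlgebra.mapDomainRingHom ℤ φ (MonoidAlgebra.of ℤ E x - 1)
      = MonoidAlgebra.of ℤ E₂ (φ x) - 1 := by
    rw [map_sub, map_one]; simp
  rw [Ideal.mem_comap, h2] at hx'
  exact hx'

end RelativeDimension

/-! ### The quotients of `E` and the map `[ , ] ω₁` -/

section Commutation

variable {E : Type u} [Group E]

/-- For subgroups `K ≤ H` of `E` with `K` normal in `E`, the quotient `H / K`. -/
abbrev SubQuot (H K : Subgroup E) : Type u := H ⧸ K.subgroupOf H

/-- The inclusion of `H / K` into `E / K`. -/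
def SubQuot.incl (H K : Subgroup E) [K.Normal] : SubQuot H K →* E ⧸ K :=
  QuotientGroup.map (K.subgroupOf H) K H.subtype le_rfl

theorem SubQuot.incl_injective (H K : Subgroup E) [K.Normal] :
    Function.Injective (SubQuot.incl H K) := by
  rw [injective_iff_map_eq_one]
  intro x
  induction x using QuotientGroup.induction_on with
  | H x =>
    intro h
    exact (QuotientGroup.eq_one_iff x).2 ((QuotientGroup.eq_one_iff (x : E)).1 h)

variable (E) in
/-- The third term `γ₃(E) = [[E, E], E]` of the lower central series. -/
abbrev gammaThree : Subgroup E := (⊤ : Subgroup E).lowerCentralSeries 2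

theorem commutator_mem_gammaThree {x : E} (hx : x ∈ commutator E) (y : E) :
    ⁅x, y⁆ ∈ gammaThree E :=
  Subgroup.commutator_mem_commutator
    (by rwa [Subgroup.top_lowerCentralSeries_one]) (Subgroup.mem_top y)

theorem gammaThree_le_commutator : gammaThree E ≤ commutator E := by
  refine le_trans (Subgroup.lowerCentralSeries_antitone (⊤ : Subgroup E) (by norm_num : 1 ≤ 2)) ?_
  rw [Subgroup.top_lowerCentralSeries_one]

/-- The subgroup `N E'`. -/
abbrev derivedSup (N : Subgroup E) : Subgroup E := N ⊔ commutator E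

/-- The subgroup `N' γ₃(E)`. -/
abbrev relGammaThree (N : Subgroup E) : Subgroup E := ⁅N, N⁆ ⊔ gammaThree E

/-- The abelian group `E / N E'`, which is `(E / N)_ab`, written additively. -/
abbrev AbQuot (N : Subgroup E) [N.Normal] : Type u := Additive (E ⧸ derivedSup N)

instance (N : Subgroup E) [N.Normal] : AddCommGroup (AbQuot N) where
  add_comm x y := by
    induction x using Additive.rec with | ofMul x => ?_
    induction y using Additive.rec with | ofMul y => ?_
    induction x using QuotientGroup.induction_on with | H x => ?_
    induction y using QuotientGroup.induction_on with | H y => ?_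
    refine congrArg Additive.ofMul (QuotientGroup.eq.2 (Subgroup.mem_sup_right ?_))
    have h : (x * y)⁻¹ * (y * x) = ⁅y⁻¹, x⁻¹⁆ := by simp [commutatorElement_def, mul_assoc]
    rw [h]
    exact Subgroup.commutator_mem_commutator (Subgroup.mem_top _) (Subgroup.mem_top _)

/-- The subgroup `N E' / E'` of `E_ab`, written additively. -/
abbrev DerivedQuot (N : Subgroup E) : Type u := Additive (SubQuot (derivedSup N) (commutator E))

/-- The injection `i : N E' / E' → E_ab`. -/
def derivedQuotIncl (N : Subgroup E) : DerivedQuot N →+ Additive (Abelianization E) :=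
  MonoidHom.toAdditive (SubQuot.incl (derivedSup N) (commutator E))

instance (N : Subgroup E) : AddCommGroup (DerivedQuot N) where
  add_comm x y := by
    have hinj : Function.Injective (derivedQuotIncl N) :=
      SubQuot.incl_injective (derivedSup N) (commutator E)
    apply hinj
    rw [map_add, map_add, add_comm]

/-- The projection `q : E_ab → E / N E'`. -/
def derivedQuotProj (N : Subgroup E) [N.Normal] : Additive (Abelianization E) →+ AbQuot N :=
  MonoidHom.toAdditive
    (QuotientGroup.map (commutator E) (derivedSup N) (MonoidHom.id E) le_sup_right)

theorem derivedQuotIncl_injective (N : Subgroup E) : Function.Injective (derivedQuotIncl N) :=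
  SubQuot.incl_injective (derivedSup N) (commutator E)

theorem derivedQuotProj_surjective (N : Subgroup E) [N.Normal] :
    Function.Surjective (derivedQuotProj N) := by
  intro x
  induction x using Additive.rec with | ofMul x => ?_
  induction x using QuotientGroup.induction_on with | H x => ?_
  exact ⟨Additive.ofMul (QuotientGroup.mk x), rfl⟩

theorem derivedQuot_exact (N : Subgroup E) [N.Normal] :
    Function.Exact (derivedQuotIncl N) (derivedQuotProj N) := by
  intro d
  constructor
  · intro h
    induction d using Additive.rec with | ofMul d => ?_
    induction d using QuotientGroup.induction_on with | H d => ?_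
    have hd : d ∈ derivedSup N := (QuotientGroup.eq_one_iff d).1 h
    exact ⟨Additive.ofMul (QuotientGroup.mk ⟨d, hd⟩), rfl⟩
  · rintro ⟨x, rfl⟩
    induction x using Additive.rec with | ofMul x => ?_
    induction x using QuotientGroup.induction_on with | H x => ?_
    exact (QuotientGroup.eq_one_iff (x : E)).2 x.2

theorem commutator_mem_sup_gammaThree (N : Subgroup E) [N.Normal] {x : E}
    (hx : x ∈ derivedSup N) (y : E) : ⁅x, y⁆ ∈ N ⊔ gammaThree E := by
  obtain ⟨n, hn, e, he, rfl⟩ := Subgroup.mem_sup_of_normal_right.1 hx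
  rw [commutatorElement_mul_left_eq_conj_mul]
  refine mul_mem (Subgroup.mem_sup_right ?_) (Subgroup.mem_sup_left ?_)
  · exact Subgroup.Normal.conj_mem inferInstance _ (commutator_mem_gammaThree he y) n
  · exact Subgroup.commutator_le_left N ⊤
      (Subgroup.commutator_mem_commutator hn (Subgroup.mem_top y))

theorem commutator_mem_relGammaThree (N : Subgroup E) [N.Normal] {x y : E}
    (hx : x ∈ derivedSup N) (hy : y ∈ derivedSup N) : ⁅x, y⁆ ∈ relGammaThree N := by
  obtain ⟨n, hn, e, he, rfl⟩ := Subgroup.mem_sup_of_normal_right.1 hx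
  obtain ⟨n', hn', e', he', rfl⟩ := Subgroup.mem_sup_of_normal_right.1 hy
  rw [commutatorElement_mul_left_eq_conj_mul, commutatorElement_mul_right_eq_mul_conj n]
  refine mul_mem (Subgroup.mem_sup_right ?_) ?_
  · exact Subgroup.Normal.conj_mem inferInstance _ (commutator_mem_gammaThree he _) n
  · have h1 : ⁅n, n'⁆ ∈ relGammaThree N :=
      Subgroup.mem_sup_left (Subgroup.commutator_mem_commutator hn hn')
    have h2 : ⁅n, e'⁆ ∈ gammaThree E := by
      rw [← commutatorElement_inv]
      exact inv_mem (commutator_mem_gammaThree he' n)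
    have h3 : n' * ⁅n, e'⁆ * n'⁻¹ ∈ relGammaThree N :=
      Subgroup.mem_sup_right (Subgroup.Normal.conj_mem inferInstance _ h2 n')
    simpa [mul_assoc] using mul_mem h1 h3

/-- Conjugation does not change an element of `E'` modulo `N' γ₃(E)`. -/
theorem conj_commutator_eq (N : Subgroup E) [N.Normal] {c : E} (hc : c ∈ commutator E) (g : E) :
    (QuotientGroup.mk (g * c * g⁻¹) : E ⧸ relGammaThree N) = QuotientGroup.mk c := by
  refine (QuotientGroup.eq.2 (Subgroup.mem_sup_right ?_)).symm
  have h := commutator_mem_gammaThree (inv_mem hc) g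
  simpa [commutatorElement_def, mul_assoc] using h

/-- The group `N γ₃(E) / N' γ₃(E)`, written additively. -/
abbrev CommTarget (N : Subgroup E) [N.Normal] : Type u :=
  Additive (SubQuot (N ⊔ gammaThree E) (relGammaThree N))

instance (N : Subgroup E) [N.Normal] : AddCommGroup (CommTarget N) where
  add_comm x y := by
    induction x using Additive.rec with | ofMul x => ?_
    induction y using Additive.rec with | ofMul y => ?_
    induction x using QuotientGroup.induction_on with | H x => ?_
    induction y using QuotientGroup.induction_on with | H y => ?_
    refine congrArg Additive.ofMul (QuotientGroup.eq.2 (Subgroup.mem_subgroupOf.2 ?_))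
    have h : (((x * y)⁻¹ * (y * x) : (N ⊔ gammaThree E : Subgroup E)) : E)
        = ⁅(y : E)⁻¹, (x : E)⁻¹⁆ := by
      push_cast
      simp [commutatorElement_def, mul_assoc]
    rw [h]
    have hle : N ⊔ gammaThree E ≤ derivedSup N := sup_le_sup_left gammaThree_le_commutator N
    exact commutator_mem_relGammaThree N (inv_mem (hle y.2)) (inv_mem (hle x.2))

/-- For `x ∈ N E'` and `b ∈ E`, the class of `[x, b]` in `N γ₃(E) / N' γ₃(E)`. -/
def commClass (N : Subgroup E) [N.Normal] (x : derivedSup N) (b : E) : CommTarget N :=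
  Additive.ofMul (QuotientGroup.mk ⟨⁅(x : E), b⁆, commutator_mem_sup_gammaThree N x.2 b⟩)

theorem commClass_incl (N : Subgroup E) [N.Normal] (x : derivedSup N) (b : E) :
    SubQuot.incl _ _ (commClass N x b).toMul
      = (QuotientGroup.mk ⁅(x : E), b⁆ : E ⧸ relGammaThree N) := rfl

theorem mem_commutator_commutatorElement (x y : E) : ⁅x, y⁆ ∈ commutator E :=
  Subgroup.commutator_mem_commutator (Subgroup.mem_top x) (Subgroup.mem_top y)

theorem commClass_mul_left (N : Subgroup E) [N.Normal] (x y : derivedSup N) (b : E) :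
    commClass N (x * y) b = commClass N x b + commClass N y b := by
  rw [add_comm]
  apply SubQuot.incl_injective (N ⊔ gammaThree E) (relGammaThree N)
  change (QuotientGroup.mk ⁅(x : E) * y, b⁆ : E ⧸ relGammaThree N)
    = QuotientGroup.mk ⁅(y : E), b⁆ * QuotientGroup.mk ⁅(x : E), b⁆
  rw [commutatorElement_mul_left_eq_conj_mul, QuotientGroup.mk_mul,
    conj_commutator_eq N (mem_commutator_commutatorElement _ _)]

theorem commClass_mul_right (N : Subgroup E) [N.Normal] (x : derivedSup N) (b c : E) :
    commClass N x (b * c) = commClass N x b + commClass N x c := by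
  apply SubQuot.incl_injective (N ⊔ gammaThree E) (relGammaThree N)
  change (QuotientGroup.mk ⁅(x : E), b * c⁆ : E ⧸ relGammaThree N)
    = QuotientGroup.mk ⁅(x : E), b⁆ * QuotientGroup.mk ⁅(x : E), c⁆
  have h : ⁅(x : E), b * c⁆ = ⁅(x : E), b⁆ * (b * ⁅(x : E), c⁆ * b⁻¹) := by
    rw [commutatorElement_mul_right_eq_mul_conj]; simp only [mul_assoc]
  rw [h, QuotientGroup.mk_mul, conj_commutator_eq N (mem_commutator_commutatorElement _ _)]

/-- For fixed `x ∈ N E'`, the homomorphism `b N E' ↦ [x, b]` on `E / N E'`. -/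
def commRight (N : Subgroup E) [N.Normal] (x : derivedSup N) : AbQuot N →+ CommTarget N :=
  MonoidHom.toAdditive (QuotientGroup.lift (derivedSup N)
    (MonoidHom.mk' (fun b => (commClass N x b).toMul) fun b c => commClass_mul_right N x b c)
    (fun _ hb => (QuotientGroup.eq_one_iff _).2 (Subgroup.mem_subgroupOf.2
      (commutator_mem_relGammaThree N x.2 hb))))

/-- Commutation in `E` as a biadditive map `(N E' / E') × (E / N E') → N γ₃(E) / N' γ₃(E)`. -/
def commBi (N : Subgroup E) [N.Normal] : DerivedQuot N →+ AbQuot N →+ CommTarget N :=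
  MonoidHom.toAdditiveLeft (QuotientGroup.lift ((commutator E).subgroupOf (derivedSup N))
    (MonoidHom.mk' (fun x => Multiplicative.ofAdd (commRight N x)) (by
      intro x y
      refine congrArg Multiplicative.ofAdd (AddMonoidHom.ext fun b => ?_)
      induction b using Additive.rec with | ofMul b => ?_
      induction b using QuotientGroup.induction_on with | H b => ?_
      exact commClass_mul_left N x y b))
    (by
      intro x hx
      refine congrArg Multiplicative.ofAdd (AddMonoidHom.ext fun b => ?_)
      induction b using Additive.rec with | ofMul b => ?_
      induction b using QuotientGroup.induction_on with | H b => ?_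
      exact (QuotientGroup.eq_one_iff _).2 (Subgroup.mem_subgroupOf.2
        (Subgroup.mem_sup_right (commutator_mem_gammaThree hx b)))))

/-- The commutation homomorphism `[ , ] : (N E' / E') ⊗ (E / N E') → N γ₃(E) / N' γ₃(E)`,
`x E' ⊗ b N E' ↦ [x, b] N' γ₃(E)`. -/
noncomputable def commHom (N : Subgroup E) [N.Normal] :
    DerivedQuot N ⊗[ℤ] AbQuot N →+ CommTarget N :=
  TensorProduct.liftAddHom (commBi N) fun r x b => by
    rw [map_zsmul, map_zsmul, AddMonoidHom.smul_apply]

theorem commHom_tmul (N : Subgroup E) [N.Normal] (x : derivedSup N) (b : E) :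
    commHom N ((Additive.ofMul (QuotientGroup.mk x) : DerivedQuot N) ⊗ₜ[ℤ]
      (Additive.ofMul (QuotientGroup.mk b) : AbQuot N)) = commClass N x b := rfl

/-- The connecting homomorphism `ω₁ : Tor(G_ab, G_ab) → (N E' / E') ⊗ G_ab` of the short exact
sequence `N E' / E' → E_ab → G_ab`, where `G_ab = E / N E'`. -/
noncomputable def omegaOne (N : Subgroup E) [N.Normal] :
    TorsionProduct (AbQuot N) (AbQuot N) →+ DerivedQuot N ⊗[ℤ] AbQuot N :=
  torConnecting (derivedQuotIncl N) (derivedQuotProj N) (derivedQuotIncl_injective N)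
    (derivedQuot_exact N) (derivedQuotProj_surjective N)

/-- The composite `[ , ] ω₁ : Tor(G_ab, G_ab) → N γ₃(E) / N' γ₃(E)`. -/
noncomputable def commOmegaOne (N : Subgroup E) [N.Normal] :
    TorsionProduct (AbQuot N) (AbQuot N) →+ CommTarget N :=
  (commHom N).comp (omegaOne N)

/-- The relative dimension quotient `D₃(E, N) / N' γ₃(E)`. -/
abbrev RelDimQuot (N : Subgroup E) [N.Normal] : Type u :=
  SubQuot (relDimSubgroup N 3) (relGammaThree N)

end Commutation

/-! ### Naturality -/

section Naturality

variable {E E₂ : Type u} [Group E] [Group E₂]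

theorem map_commutator_le (φ : E →* E₂) : commutator E ≤ (commutator E₂).comap φ := by
  rw [commutator_def, Subgroup.commutator_le]
  intro x _ y _
  rw [Subgroup.mem_comap, map_commutatorElement]
  exact mem_commutator_commutatorElement _ _

theorem derivedSup_le_comap (N : Subgroup E) (N₂ : Subgroup E₂) (φ : E →* E₂)
    (h : N ≤ (derivedSup N₂).comap φ) : derivedSup N ≤ (derivedSup N₂).comap φ :=
  sup_le h ((map_commutator_le φ).trans (Subgroup.comap_mono le_sup_right))

theorem relGammaThree_le_comap (N : Subgroup E) (N₂ : Subgroup E₂) [N₂.Normal] (φ : E →* E₂)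
    (h : N ≤ (derivedSup N₂).comap φ) : relGammaThree N ≤ (relGammaThree N₂).comap φ := by
  refine sup_le (Subgroup.commutator_le.2 fun x hx y hy => ?_) ?_
  · rw [Subgroup.mem_comap, map_commutatorElement]
    exact commutator_mem_relGammaThree N₂ (h hx) (h hy)
  · refine Subgroup.commutator_le.2 fun x hx y _ => ?_
    rw [Subgroup.mem_comap, map_commutatorElement]
    rw [Subgroup.top_lowerCentralSeries_one] at hx
    exact Subgroup.mem_sup_right (commutator_mem_gammaThree (map_commutator_le φ hx) _)

/-- The homomorphism `E / N E' → E₂ / N₂ E₂'` induced by `φ : E → E₂` with `φ(N) ⊆ N₂ E₂'`. -/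
def AbQuot.map (N : Subgroup E) [N.Normal] (N₂ : Subgroup E₂) [N₂.Normal] (φ : E →* E₂)
    (h : N ≤ (derivedSup N₂).comap φ) : AbQuot N →+ AbQuot N₂ :=
  MonoidHom.toAdditive
    (QuotientGroup.map (derivedSup N) (derivedSup N₂) φ (derivedSup_le_comap N N₂ φ h))

/-- The homomorphism `D₃(E, N) / N' γ₃(E) → D₃(E₂, N₂) / N₂' γ₃(E₂)` induced by `φ : E → E₂` with
`φ(N) ⊆ N₂ E₂'`. -/
noncomputable def RelDimQuot.map (N : Subgroup E) [N.Normal] (N₂ : Subgroup E₂) [N₂.Normal] (φ : E →* E₂)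
    (h : N ≤ (derivedSup N₂).comap φ) : RelDimQuot N →* RelDimQuot N₂ :=
  QuotientGroup.map _ _
    ((φ.comp (relDimSubgroup N 3).subtype).codRestrict (relDimSubgroup N₂ 3)
      fun x => relDimSubgroup_three_le_comap N N₂ φ h x.2)
    fun _ hx => relGammaThree_le_comap N N₂ φ h hx

theorem RelDimQuot.map_mk (N : Subgroup E) [N.Normal] (N₂ : Subgroup E₂) [N₂.Normal]
    (φ : E →* E₂) (h : N ≤ (derivedSup N₂).comap φ) (x : relDimSubgroup N 3) :
    RelDimQuot.map N N₂ φ h (QuotientGroup.mk x) =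
      QuotientGroup.mk ⟨φ x, relDimSubgroup_three_le_comap N N₂ φ h x.2⟩ := rfl

end Naturality

/-! Write $V=F_{ab}$, $A=F/RF'$ and $q:V\to A$. On symbols the map is $\tau_m(qx,qy)\mapsto[x^m,y]$,
so everything depends on recognising products of such commutators modulo $R'\gamma_3(F)$. The tool
is a quadratic map: $c:F\to M$ with $c(xy)=c(x)+c(y)+B(\bar x,\bar y)$ for a bilinear form $B$ on
$V$. It is additive on $F'$, satisfies $c([x,y])=B(\bar x,\bar y)-B(\bar y,\bar x)$ and kills
$\gamma_3(F)$. Because $F$ is free, every $B$ has such a $c$ (`IsFreeGroup.exists_isQuadraticMap`).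
Extended linearly to $\mathbb Z[F]$, $c$ is given by $B$ on products from the augmentation ideal, so
it kills $D_3(F,R)$ as soon as $B$ vanishes on $R\times F$.

Coordinates come from Smith normal form: any finite subset of $V$ lies in the span of elements $e_i$
with dual functionals $\varepsilon_i$, such that $\sum x_i q(e_i)=0$ exactly when $d_i\mid x_i$ for
all $i$ (`AdaptedFamily.exists_spanned`; $d_i=0$ is allowed).

Values in $D_3$: $x\mapsto x-1$ modulo $\mathfrak n\mathfrak e+\mathfrak e^3$ is itself quadratic,
with form $(x-1)(y-1)$, and the exponent $m$ can be moved from $x$ to $y$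
(`commutator_pow_mem_relDimSubgroup`).

Injectivity (`ker_torComm`): write the class of $t$ as $\sum k_{ij}\,\tau_{l_{ij}}(qe_i,qe_j)$ with
$l_{ij}=\mathrm{lcm}(d_i,d_j)$, and let $f\in F'$ represent its image. The quadratic map for
$\varepsilon_i\otimes\varepsilon_j$ has value $(k_{ij}-k_{ji})l_{ij}$ at $f$, while on
$R'\gamma_3(F)$ its values are divisible by $d_id_j$. If $f\in R'\gamma_3(F)$, this divisibility
makes every antisymmetrised term vanish.

Surjectivity (`mem_range_torComm`): an element $f$ of $D_3(F,R)$ lies in $F'$, so it is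
$\prod[e_i,e_j]^{k_{ij}}$ modulo $R'\gamma_3(F)$. The forms $(v,w)\mapsto\varepsilon_j(w)\,q(v)$
vanish on $R\times F$ and give $\sum_i(k_{ij}-k_{ji})q(e_i)=0$. Hence $k_{ij}-k_{ji}$ kills both
$qe_i$ and $qe_j$, and each factor $[e_i,e_j]^{k_{ij}-k_{ji}}$ with $i<j$ is an image of a symbol up
to sign. -/

/-! ### Quadratic functions on a group -/

section Quadratic

variable {E : Type*} [Group E]

/-- The class of `x` in `E_ab`, written additively. -/
def abClass (x : E) : Additive (Abelianization E) := Additive.ofMul (Abelianization.of x)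

theorem abClass_one : abClass (1 : E) = 0 := rfl

theorem abClass_mul (x y : E) : abClass (x * y) = abClass x + abClass y := rfl

theorem abClass_pow (x : E) (n : ℕ) : abClass (x ^ n) = n • abClass x := rfl

theorem abClass_surjective : Function.Surjective (abClass (E := E)) := by
  intro v
  induction v using Additive.rec with | ofMul v => ?_
  induction v using QuotientGroup.induction_on with | H x => ?_
  exact ⟨x, rfl⟩

theorem abClass_eq_zero {x : E} : abClass x = 0 ↔ x ∈ commutator E :=
  QuotientGroup.eq_one_iff x

variable {M : Type*} [AddCommGroup M]

/-- A function `c` on `E` whose deviation from additivity is the bilinear form `B` on `E_ab`. -/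
def IsQuadraticMap (B : Additive (Abelianization E) →+ Additive (Abelianization E) →+ M)
    (c : E → M) : Prop :=
  ∀ x y, c (x * y) = c x + c y + B (abClass x) (abClass y)

namespace IsQuadraticMap

variable {B : Additive (Abelianization E) →+ Additive (Abelianization E) →+ M} {c : E → M}

theorem map_one (h : IsQuadraticMap B c) : c 1 = 0 := by
  have := h 1 1
  simpa [abClass_one] using this

theorem map_mul_of_mem (h : IsQuadraticMap B c) {x : E} (hx : x ∈ commutator E) (y : E) :
    c (x * y) = c x + c y := by
  rw [h, abClass_eq_zero.2 hx, map_zero, AddMonoidHom.zero_apply, add_zero]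

theorem map_inv_of_mem (h : IsQuadraticMap B c) {x : E} (hx : x ∈ commutator E) :
    c x⁻¹ = -c x := by
  have := h.map_mul_of_mem hx x⁻¹
  rw [mul_inv_cancel, h.map_one] at this
  exact (neg_eq_of_add_eq_zero_right this.symm).symm

/-- Evaluate `c` on $[x,y]\cdot yx=xy$: it is additive across the factor from $E'$, and the terms
$c(x)+c(y)$ cancel. -/
theorem map_commutatorElement (h : IsQuadraticMap B c) (x y : E) :
    c ⁅x, y⁆ = B (abClass x) (abClass y) - B (abClass y) (abClass x) := by
  have h1 := h.map_mul_of_mem (mem_commutator_commutatorElement x y) (y * x)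
  have h2 : ⁅x, y⁆ * (y * x) = x * y := by simp [commutatorElement_def, mul_assoc]
  rw [h2, h, h] at h1
  rw [← sub_eq_zero] at h1 ⊢
  rw [← neg_eq_zero, ← h1]
  abel

theorem map_eq_zero_of_mem_gammaThree {E : Type u} [Group E]
    {B : Additive (Abelianization E) →+ Additive (Abelianization E) →+ M} {c : E → M}
    (h : IsQuadraticMap B c) {x : E} (hx : x ∈ gammaThree E) :
    c x = 0 := by
  have key : x ∈ commutator E ∧ c x = 0 := by
    refine Subgroup.closure_induction (p := fun x _ => x ∈ commutator E ∧ c x = 0)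
      ?_ ⟨one_mem _, h.map_one⟩ ?_ ?_ hx
    · rintro _ ⟨a, ha, b, -, rfl⟩
      rw [Subgroup.top_lowerCentralSeries_one] at ha
      refine ⟨mem_commutator_commutatorElement a b, ?_⟩
      rw [h.map_commutatorElement, abClass_eq_zero.2 ha]
      simp
    · rintro x y - - ⟨hx, hx'⟩ ⟨hy, hy'⟩
      exact ⟨mul_mem hx hy, by rw [h.map_mul_of_mem hx, hx', hy', add_zero]⟩
    · rintro x - ⟨hx, hx'⟩
      exact ⟨inv_mem hx, by rw [h.map_inv_of_mem hx, hx', neg_zero]⟩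
  exact key.2

end IsQuadraticMap

/-- The central extension of `V` by `M` defined by a bilinear form on `V`. -/
structure BilinExtension {V M : Type*} [AddCommGroup V] [AddCommGroup M] (B : V →+ V →+ M) where
  fst : V
  snd : M

namespace BilinExtension

variable {V : Type*} [AddCommGroup V] {B : V →+ V →+ M}

instance : Mul (BilinExtension B) := ⟨fun x y => ⟨x.fst + y.fst, x.snd + y.snd + B x.fst y.fst⟩⟩
instance : One (BilinExtension B) := ⟨⟨0, 0⟩⟩
-- The term `B x.fst x.fst` cancels the cocycle value $B(-v,v)=-B(v,v)$.
instance : Inv (BilinExtension B) := ⟨fun x => ⟨-x.fst, -x.snd + B x.fst x.fst⟩⟩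

theorem mul_eq (x y : BilinExtension B) :
    x * y = ⟨x.fst + y.fst, x.snd + y.snd + B x.fst y.fst⟩ := rfl
theorem one_eq : (1 : BilinExtension B) = ⟨0, 0⟩ := rfl
theorem inv_eq (x : BilinExtension B) : x⁻¹ = ⟨-x.fst, -x.snd + B x.fst x.fst⟩ := rfl

instance : Group (BilinExtension B) := Group.ofLeftAxioms
  (fun x y z => by
    simp only [mul_eq, map_add, AddMonoidHom.add_apply, mk.injEq]
    exact ⟨by abel, by abel⟩)
  (fun x => by simp [mul_eq, one_eq])
  (fun x => by simp [mul_eq, one_eq, inv_eq])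

/-- The projection onto `V`. -/
def proj : BilinExtension B →* Multiplicative V where
  toFun x := Multiplicative.ofAdd x.fst
  map_one' := rfl
  map_mul' _ _ := rfl

end BilinExtension

/-- Freeness enters here: lift the generators to the central extension of $E_{ab}$ by $M$ with
cocycle $B$. The resulting homomorphism lies over the abelianization, so its $M$-component is
quadratic with form $B$. -/
theorem IsFreeGroup.exists_isQuadraticMap [IsFreeGroup E]
    (B : Additive (Abelianization E) →+ Additive (Abelianization E) →+ M) :
    ∃ c : E → M, IsQuadraticMap B c := by
  let θ : E →* BilinExtension B := IsFreeGroup.lift fun a => ⟨abClass (IsFreeGroup.of a), 0⟩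
  have hθ : BilinExtension.proj.comp θ
      = MonoidHom.mk' (fun x => Multiplicative.ofAdd (abClass x)) (fun _ _ => rfl) := by
    refine IsFreeGroup.ext_hom fun a => ?_
    rw [MonoidHom.comp_apply, IsFreeGroup.lift_of]
    rfl
  have hfst : ∀ x, (θ x).fst = abClass x := fun x => DFunLike.congr_fun hθ x
  refine ⟨fun x => (θ x).snd, fun x y => ?_⟩
  simp only [map_mul, BilinExtension.mul_eq, hfst]

end Quadratic

/-! ### Quadratic functions and the relative dimension ideal -/

section QuadraticIdeal

variable {E : Type u} [Group E] {M : Type*} [AddCommGroup M]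

/-- The additive extension of a function on `E` to `ℤ[E]`. -/
noncomputable def linExtend (c : E → M) : MonoidAlgebra ℤ E →+ M :=
  (Finsupp.liftAddHom fun x => zmultiplesHom M (c x)).comp
    MonoidAlgebra.coeffAddEquiv.toAddMonoidHom

theorem linExtend_of (c : E → M) (x : E) : linExtend c (MonoidAlgebra.of ℤ E x) = c x :=
  (Finsupp.liftAddHom_apply_single _ _ _).trans (one_zsmul _)

/-- The augmentation of `ℤ[E]`. -/
noncomputable def augHom : MonoidAlgebra ℤ E →+* ℤ :=
  (MonoidAlgebra.lift ℤ ℤ E (1 : E →* ℤ)).toRingHom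

theorem augHom_of (x : E) : augHom (MonoidAlgebra.of ℤ E x) = 1 := by
  simp [augHom]

theorem mem_augIdeal {x : MonoidAlgebra ℤ E} : x ∈ augIdeal E ↔ augHom x = 0 := Iff.rfl

theorem monoidAlgebra_int_induction {p : MonoidAlgebra ℤ E → Prop}
    (of : ∀ x, p (MonoidAlgebra.of ℤ E x)) (add : ∀ x y, p x → p y → p (x + y))
    (neg : ∀ x, p x → p (-x)) (x : MonoidAlgebra ℤ E) : p x := by
  have zero : p 0 := by simpa using add _ _ (of 1) (neg _ (of 1))
  refine MonoidAlgebra.induction_on x of add fun r a ha => ?_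
  induction r using Int.induction_on with
  | zero => simpa using zero
  | succ n ih => rw [add_smul, one_smul]; exact add _ _ ih ha
  | pred n ih => rw [sub_smul, one_smul, sub_eq_add_neg]; exact add _ _ ih (neg _ ha)

/-- Both sides are biadditive in the two ring elements. On group elements, where the augmentation is
1, the identity is the defining one. -/
theorem IsQuadraticMap.linExtend_mul
    {B : Additive (Abelianization E) →+ Additive (Abelianization E) →+ M} {c : E → M}
    (h : IsQuadraticMap B c) (x y : MonoidAlgebra ℤ E) :
    linExtend c (x * y) = augHom x • linExtend c y + augHom y • linExtend c x
      + B (linExtend abClass x) (linExtend abClass y) := by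
  induction x using monoidAlgebra_int_induction with
  | of x =>
    induction y using monoidAlgebra_int_induction with
    | of y =>
      rw [← map_mul, linExtend_of, linExtend_of, linExtend_of, linExtend_of, linExtend_of,
        augHom_of, augHom_of, h, one_smul, one_smul, add_comm (c x)]
    | add y z hy hz =>
      rw [mul_add, map_add, map_add, map_add, map_add, map_add, hy, hz, smul_add, add_smul]
      abel
    | neg y hy =>
      rw [mul_neg, map_neg, map_neg, map_neg, map_neg, map_neg, hy, smul_neg, neg_smul]
      abel
  | add x z hx hz =>
    rw [add_mul, map_add, map_add, map_add, map_add, map_add, hx, hz, smul_add, add_smul,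
      AddMonoidHom.add_apply]
    abel
  | neg x hx =>
    rw [neg_mul, map_neg, map_neg, map_neg, map_neg, map_neg, hx, smul_neg, neg_smul,
      AddMonoidHom.neg_apply]
    abel

/-- Treating the abelianization map as quadratic with zero form lets the general results apply to
it. They show that it kills $\mathfrak e^2$ and that $D_3(E,N)\subseteq E'$. -/
theorem isQuadraticMap_abClass :
    IsQuadraticMap (0 : Additive (Abelianization E) →+ Additive (Abelianization E) →+ _)
      (abClass (E := E)) := fun x y => by
  simp [abClass_mul]

theorem linExtend_abClass_mul {x y : MonoidAlgebra ℤ E} (hx : x ∈ augIdeal E)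
    (hy : y ∈ augIdeal E) : linExtend abClass (x * y) = 0 := by
  rw [isQuadraticMap_abClass.linExtend_mul, mem_augIdeal.1 hx, mem_augIdeal.1 hy]
  simp

theorem IsQuadraticMap.linExtend_mul_of_mem
    {B : Additive (Abelianization E) →+ Additive (Abelianization E) →+ M} {c : E → M}
    (h : IsQuadraticMap B c) {x y : MonoidAlgebra ℤ E} (hx : x ∈ augIdeal E)
    (hy : y ∈ augIdeal E) :
    linExtend c (x * y) = B (linExtend abClass x) (linExtend abClass y) := by
  rw [h.linExtend_mul, mem_augIdeal.1 hx, mem_augIdeal.1 hy]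
  simp

theorem linExtend_ideal_mul_eq_zero {c : E → M} {I J : Ideal (MonoidAlgebra ℤ E)}
    (h : ∀ x ∈ I, ∀ y ∈ J, linExtend c (x * y) = 0) {z : MonoidAlgebra ℤ E} (hz : z ∈ I * J) :
    linExtend c z = 0 := by
  refine Submodule.mul_induction_on hz h fun x y hx hy => ?_
  rw [map_add, hx, hy, add_zero]

theorem subAugIdeal_le_augIdeal (N : Subgroup E) : subAugIdeal N ≤ augIdeal E := by
  refine Ideal.span_le.2 ?_
  rintro _ ⟨n, -, rfl⟩
  exact of_sub_one_mem_augIdeal n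

/-- A left multiplier acts on the class only through its augmentation, because elements of the ideal
have augmentation zero. So the generators $n-1$ decide. The subgroup used later is the kernel of a
bilinear form. -/
theorem linExtend_abClass_mem_of_mem_subAugIdeal {N : Subgroup E}
    {K : AddSubgroup (Additive (Abelianization E))} (hK : ∀ n ∈ N, abClass n ∈ K)
    {x : MonoidAlgebra ℤ E} (hx : x ∈ subAugIdeal N) : linExtend abClass x ∈ K := by
  refine Submodule.span_induction ?_ ?_ ?_ ?_ hx
  · rintro _ ⟨n, hn, rfl⟩
    rw [map_sub, ← map_one (MonoidAlgebra.of ℤ E), linExtend_of, linExtend_of, abClass_one,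
      sub_zero]
    exact hK n hn
  · rw [map_zero]; exact zero_mem K
  · intro x y _ _ hx hy
    rw [map_add]; exact add_mem hx hy
  · intro a x hx ih
    rw [smul_eq_mul, isQuadraticMap_abClass.linExtend_mul,
      mem_augIdeal.1 (subAugIdeal_le_augIdeal N hx)]
    simpa using zsmul_mem ih _

/-- A quadratic map whose bilinear form vanishes on `N × E` vanishes on `𝔫 𝔢 + 𝔢³`. -/
theorem IsQuadraticMap.linExtend_eq_zero_of_mem_relDimIdeal
    {B : Additive (Abelianization E) →+ Additive (Abelianization E) →+ M} {c : E → M}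
    (h : IsQuadraticMap B c) {N : Subgroup E} (hB : ∀ n ∈ N, B (abClass n) = 0)
    {x : MonoidAlgebra ℤ E} (hx : x ∈ relDimIdeal N 3) : linExtend c x = 0 := by
  obtain ⟨a, ha, b, hb, rfl⟩ := Submodule.mem_sup.1 hx
  rw [Submodule.pow_succ, Submodule.pow_succ, Submodule.pow_one] at hb
  rw [map_add, linExtend_ideal_mul_eq_zero ?_ ha, linExtend_ideal_mul_eq_zero ?_ hb, add_zero]
  -- On $\mathfrak e^3=\mathfrak e^2\cdot\mathfrak e$ the left factor has zero class in $E_{ab}$.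
  · intro x hx y hy
    have hx1 : linExtend abClass x = 0 :=
      linExtend_ideal_mul_eq_zero (fun _ h1 _ h2 => linExtend_abClass_mul h1 h2) hx
    rw [h.linExtend_mul_of_mem (Ideal.mul_le_left hx) hy, hx1]
    simp
  -- On $\mathfrak n\mathfrak e$ the class of the left factor lies in the kernel of `B`.
  · intro x hx y hy
    have hx1 : linExtend abClass x ∈ B.ker :=
      linExtend_abClass_mem_of_mem_subAugIdeal hB hx
    rw [h.linExtend_mul_of_mem (subAugIdeal_le_augIdeal N hx) hy, AddMonoidHom.mem_ker.1 hx1]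
    simp

theorem IsQuadraticMap.map_eq_zero_of_mem_relDimSubgroup
    {B : Additive (Abelianization E) →+ Additive (Abelianization E) →+ M} {c : E → M}
    (h : IsQuadraticMap B c) {N : Subgroup E} (hB : ∀ n ∈ N, B (abClass n) = 0)
    {x : E} (hx : x ∈ relDimSubgroup N 3) : c x = 0 := by
  have := h.linExtend_eq_zero_of_mem_relDimIdeal hB hx
  rwa [map_sub, ← _root_.map_one (MonoidAlgebra.of ℤ E), linExtend_of, linExtend_of, h.map_one,
    sub_zero] at this

theorem relDimSubgroup_three_le_commutator (N : Subgroup E) :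
    relDimSubgroup N 3 ≤ commutator E := fun _ hx =>
  abClass_eq_zero.1 (isQuadraticMap_abClass.map_eq_zero_of_mem_relDimSubgroup
    (fun _ _ => rfl) hx)

end QuadraticIdeal

/-! ### Families adapted to a subgroup of a free abelian group -/

section Adapted

variable {V A : Type*} [AddCommGroup V] [AddCommGroup A]

/-- For a homomorphism `q : V → A`: finitely many elements `e i` of `V` with dual functionals
`ε i`, such that the relations between the `q (e i)` are generated by `d i • q (e i) = 0`. -/
structure AdaptedFamily (q : V →+ A) (n : ℕ) where
  e : Fin n → V
  ε : Fin n → V →+ ℤ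
  d : Fin n → ℕ
  ε_e : ∀ i j, ε i (e j) = if i = j then 1 else 0
  map_sum_eq_zero_iff : ∀ x : Fin n → ℤ, q (∑ i, x i • e i) = 0 ↔ ∀ i, (d i : ℤ) ∣ x i

namespace AdaptedFamily

variable {q : V →+ A} {n : ℕ} (a : AdaptedFamily q n)

/-- The subgroup generated by the members of the family. -/
def spanned : AddSubgroup V where
  carrier := {v | ∑ i, a.ε i v • a.e i = v}
  zero_mem' := by simp
  add_mem' := by
    intro v w hv hw
    rw [Set.mem_ofPred_eq] at hv hw ⊢
    simp only [map_add, add_smul, Finset.sum_add_distrib, hv, hw]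
  neg_mem' := by
    intro v hv
    rw [Set.mem_ofPred_eq] at hv ⊢
    simp only [map_neg, neg_smul, Finset.sum_neg_distrib, hv]

theorem mem_spanned {v : V} : v ∈ a.spanned ↔ ∑ i, a.ε i v • a.e i = v := Iff.rfl

theorem dvd_of_map_eq_zero {v : V} (hv : v ∈ a.spanned) (h : q v = 0) (i : Fin n) :
    (a.d i : ℤ) ∣ a.ε i v :=
  (a.map_sum_eq_zero_iff fun i => a.ε i v).1 (by rw [a.mem_spanned.1 hv, h]) i

theorem zsmul_eq_zero_iff (i : Fin n) (x : ℤ) : x • q (a.e i) = 0 ↔ (a.d i : ℤ) ∣ x := by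
  have h := a.map_sum_eq_zero_iff (Pi.single i x)
  rw [Finset.sum_eq_single i (fun j _ hj => by rw [Pi.single_eq_of_ne hj, zero_smul])
    (fun h => absurd (Finset.mem_univ i) h), Pi.single_eq_same, map_zsmul] at h
  rw [h]
  refine ⟨fun h => by simpa using h i, fun h j => ?_⟩
  obtain rfl | hj := eq_or_ne j i
  · simpa using h
  · rw [Pi.single_eq_of_ne hj]; exact dvd_zero _

theorem nsmul_eq_zero_iff (i : Fin n) (m : ℕ) : m • q (a.e i) = 0 ↔ a.d i ∣ m := by
  rw [← Int.natCast_dvd_natCast, ← a.zsmul_eq_zero_iff, natCast_zsmul]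

end AdaptedFamily

/-- The submodule may have smaller rank than the ambient module. Giving the unused basis vectors
divisor 0 makes divisibility express that those coordinates vanish. -/
theorem Module.Basis.SmithNormalForm.exists_mem_iff {W ι : Type*} [AddCommGroup W]
    [Finite ι] {N : Submodule ℤ W} {k : ℕ} (s : Module.Basis.SmithNormalForm N ι k) :
    ∃ d : ι → ℕ, ∀ w, w ∈ N ↔ ∀ i, (d i : ℤ) ∣ s.bM.repr w i := by
  classical
  cases nonempty_fintype ι
  refine ⟨Function.extend s.f (fun j => (s.a j).natAbs) 0, fun w => ?_⟩
  have hd := fun j => s.f.injective.extend_apply (fun j => (s.a j).natAbs) 0 j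
  constructor
  · intro hw i
    by_cases h : ∃ j, s.f j = i
    · obtain ⟨j, rfl⟩ := h
      rw [hd, Int.natAbs_dvd]
      refine ⟨s.bN.repr ⟨w, hw⟩ j, (s.repr_apply_embedding_eq_repr_smul ⟨w, hw⟩).trans ?_⟩
      rw [map_smul]
      rfl
    · rw [s.repr_eq_zero_of_notMem_range ⟨w, hw⟩ (by simpa using h)]
      exact dvd_zero _
  · intro h
    rw [← s.bM.sum_repr w]
    refine sum_mem fun i _ => ?_
    by_cases hi : ∃ j, s.f j = i
    · obtain ⟨j, rfl⟩ := hi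
      have := h (s.f j)
      rw [hd, Int.natAbs_dvd] at this
      obtain ⟨c, hc⟩ := this
      rw [hc, mul_comm, mul_smul, ← s.snf]
      exact N.smul_mem _ (s.bN j).2
    · have := h i
      rw [Function.extend_apply' _ _ _ hi, Pi.zero_apply, Nat.cast_zero, zero_dvd_iff] at this
      rw [this, zero_smul]
      exact zero_mem _

/-- Finitely many vectors involve finitely many basis elements of `V`, which span a direct summand
of finite rank. Smith normal form for the kernel of `q` on that summand yields the family, and the
projection onto the summand extends the coordinate functionals to all of `V`. -/
theorem AdaptedFamily.exists_spanned [Module.Free ℤ V] (q : V →+ A) {S : Set V}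
    (hS : S.Finite) : ∃ (n : ℕ) (a : AdaptedFamily q n), S ⊆ a.spanned := by
  classical
  let b := Module.Free.chooseBasis ℤ V
  let T : Set (Module.Free.ChooseBasisIndex ℤ V) := ⋃ v ∈ S, (b.repr v).support
  have hT : T.Finite := hS.biUnion fun v _ => Finset.finite_toSet _
  have : Finite T := hT
  cases nonempty_fintype T
  let incl : (T →₀ ℤ) →ₗ[ℤ] V := Finsupp.linearCombination ℤ fun i : T => b i
  let proj : V →ₗ[ℤ] (T →₀ ℤ) := (Finsupp.lcomapDomain (Subtype.val : T → _)
    Subtype.val_injective).comp b.repr.toLinearMap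
  have hpi : ∀ w, proj (incl w) = w := by
    suffices h : proj.comp incl = LinearMap.id from fun w => LinearMap.congr_fun h w
    ext i j
    simp [proj, incl, Finsupp.lcomapDomain, Finsupp.single_apply, Subtype.ext_iff]
  have hip : ∀ v ∈ S, incl (proj v) = v := by
    intro v hv
    have hsupp : SetLike.coe (b.repr v).support ⊆ Set.range (Subtype.val : T → _) := by
      rw [Subtype.range_coe]
      exact Set.subset_biUnion_of_mem (u := fun v => SetLike.coe (b.repr v).support) hv
    have h := Finsupp.mapDomain_comapDomain _ Subtype.val_injective (b.repr v) hsupp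
    change Finsupp.linearCombination ℤ (b ∘ Subtype.val) (proj v) = v
    rw [← Finsupp.linearCombination_mapDomain]
    exact (congrArg _ h).trans (b.linearCombination_repr v)
  obtain ⟨k, s⟩ := (LinearMap.ker (q.toIntLinearMap.comp incl)).smithNormalForm
    (Finsupp.basisSingleOne.reindex (Fintype.equivFin T))
  obtain ⟨d, hd⟩ := s.exists_mem_iff
  refine ⟨Fintype.card T, ⟨fun i => incl (s.bM i), fun i =>
    ((s.bM.coord i).comp proj).toAddMonoidHom, d, fun i j => ?_, fun x => ?_⟩, fun v hv => ?_⟩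
  · simp [hpi, Finsupp.single_apply, eq_comm]
  · have := hd (∑ i, x i • s.bM i)
    rw [LinearMap.mem_ker] at this
    simpa [Finsupp.single_apply] using this
  · change ∑ i, s.bM.repr (proj v) i • incl (s.bM i) = v
    conv_rhs => rw [← hip v hv, ← s.bM.sum_repr (proj v), map_sum]
    simp only [map_smul]

end Adapted

/-! ### Calculations in the torsion product -/

section TorCalculus

variable {A C : Type*} [AddCommGroup A] [AddCommGroup C]

theorem torTau_add_left (a₁ a₂ : A) (m : ℕ) (c : C) (hm : 0 < m) (h₁ : m • a₁ = 0)
    (h₂ : m • a₂ = 0) (h : m • (a₁ + a₂) = 0) (hc : m • c = 0) :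
    torTau (a₁ + a₂) m c hm h hc = torTau a₁ m c hm h₁ hc + torTau a₂ m c hm h₂ hc :=
  sub_eq_zero.1 (torTau_relator (TorRelator.add_left a₁ a₂ m c hm h₁ h₂ h hc))

theorem torTau_add_right (a : A) (m : ℕ) (c₁ c₂ : C) (hm : 0 < m) (ha : m • a = 0)
    (h₁ : m • c₁ = 0) (h₂ : m • c₂ = 0) (h : m • (c₁ + c₂) = 0) :
    torTau a m (c₁ + c₂) hm ha h = torTau a m c₁ hm ha h₁ + torTau a m c₂ hm ha h₂ :=
  sub_eq_zero.1 (torTau_relator (TorRelator.add_right a m c₁ c₂ hm ha h₁ h₂ h))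

theorem torTau_mul_left (a : A) (m n : ℕ) (c : C) (hmn : 0 < m * n) (hm : 0 < m)
    (ha : (m * n) • a = 0) (hc' : (m * n) • c = 0) (ha' : m • (n • a) = 0) (hc : m • c = 0) :
    torTau a (m * n) c hmn ha hc' = torTau (n • a) m c hm ha' hc :=
  sub_eq_zero.1 (torTau_relator (TorRelator.mul_left a m n c hmn hm ha hc' ha' hc))

theorem torTau_mul_right (a : A) (m n : ℕ) (c : C) (hmn : 0 < m * n) (hm : 0 < m)
    (ha' : (m * n) • a = 0) (hc : (m * n) • c = 0) (ha : m • a = 0) (hc' : m • (n • c) = 0) :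
    torTau a (m * n) c hmn ha' hc = torTau a m (n • c) hm ha hc' :=
  sub_eq_zero.1 (torTau_relator (TorRelator.mul_right a m n c hmn hm ha' hc ha hc'))

variable (A C) in
/-- For fixed `m`, the biadditive map `(a, c) ↦ τ_m(a, c)` on the `m`-torsion subgroups. -/
def torTauHom (m : ℕ) (hm : 0 < m) : (nsmulAddMonoidHom m : A →+ A).ker →+
    (nsmulAddMonoidHom m : C →+ C).ker →+ TorsionProduct A C :=
  AddMonoidHom.mk' (fun a => AddMonoidHom.mk' (fun c => torTau a.1 m c.1 hm a.2 c.2)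
      fun _ _ => torTau_add_right _ _ _ _ _ _ _ _ _)
    fun _ _ => AddMonoidHom.ext fun _ => torTau_add_left _ _ _ _ _ _ _ _ _

theorem torTauHom_apply (m : ℕ) (hm : 0 < m) (a : A) (c : C) (ha : m • a = 0) (hc : m • c = 0) :
    torTauHom A C m hm ⟨a, ha⟩ ⟨c, hc⟩ = torTau a m c hm ha hc := rfl

theorem torTau_zero_left (m : ℕ) (c : C) (hm : 0 < m) (h : m • (0 : A) = 0) (hc : m • c = 0) :
    torTau (0 : A) m c hm h hc = 0 :=
  DFunLike.congr_fun (map_zero (torTauHom A C m hm)) ⟨c, hc⟩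

theorem torTau_zero_right (a : A) (m : ℕ) (hm : 0 < m) (ha : m • a = 0) (h : m • (0 : C) = 0) :
    torTau a m (0 : C) hm ha h = 0 :=
  map_zero (torTauHom A C m hm ⟨a, ha⟩)

theorem torTau_neg_left (a : A) (m : ℕ) (c : C) (hm : 0 < m) (ha : m • a = 0)
    (ha' : m • (-a) = 0) (hc : m • c = 0) :
    torTau (-a) m c hm ha' hc = -torTau a m c hm ha hc :=
  DFunLike.congr_fun (map_neg (torTauHom A C m hm) ⟨a, ha⟩) ⟨c, hc⟩

theorem torTau_neg_right (a : A) (m : ℕ) (c : C) (hm : 0 < m) (ha : m • a = 0)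
    (hc : m • c = 0) (hc' : m • (-c) = 0) :
    torTau a m (-c) hm ha hc' = -torTau a m c hm ha hc :=
  map_neg (torTauHom A C m hm ⟨a, ha⟩) ⟨c, hc⟩

theorem torTau_sum {ι κ : Type*} [Fintype ι] [Fintype κ] (a : ι → A) (m : ℕ) (c : κ → C)
    (hm : 0 < m) (ha : ∀ i, m • a i = 0) (hc : ∀ j, m • c j = 0)
    (ha' : m • (∑ i, a i) = 0) (hc' : m • (∑ j, c j) = 0) :
    torTau (∑ i, a i) m (∑ j, c j) hm ha' hc' =
      ∑ i, ∑ j, torTau (a i) m (c j) hm (ha i) (hc j) := by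
  have h1 : (⟨∑ i, a i, ha'⟩ : (nsmulAddMonoidHom m : A →+ A).ker) = ∑ i, ⟨a i, ha i⟩ := by
    ext; simp
  have h2 : (⟨∑ j, c j, hc'⟩ : (nsmulAddMonoidHom m : C →+ C).ker) = ∑ j, ⟨c j, hc j⟩ := by
    ext; simp
  rw [← torTauHom_apply, h1, h2, map_sum (torTauHom A C m hm), AddMonoidHom.finsetSum_apply]
  exact Finset.sum_congr rfl fun i _ => map_sum (torTauHom A C m hm ⟨a i, ha i⟩) _ _

/-- Both sides equal $\tau_{mxy}(e,f)=\tau_{lk}(e,f)$. If $x$ or $y$ is zero that symbol is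
undefined, but then $k=0$ and both sides vanish. -/
theorem torTau_nsmul_nsmul (e : A) (f : C) (m x y l k : ℕ) (hm : 0 < m) (hx : m • (x • e) = 0)
    (hy : m • (y • f) = 0) (hl : 0 < l) (he : l • e = 0) (hf : l • f = 0)
    (h : m * x * y = k * l) :
    torTau (x • e) m (y • f) hm hx hy = k • torTau e l f hl he hf := by
  obtain rfl | hx0 := x.eq_zero_or_pos
  · have : k = 0 := by
      rw [mul_zero, zero_mul, eq_comm, mul_eq_zero] at h
      exact h.resolve_right hl.ne'
    simp only [this, zero_smul, torTau_zero_left]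
  obtain rfl | hy0 := y.eq_zero_or_pos
  · have : k = 0 := by
      rw [mul_zero, eq_comm, mul_eq_zero] at h
      exact h.resolve_right hl.ne'
    simp only [this, zero_smul, torTau_zero_right]
  have hx' : (m * x) • e = 0 := by rw [mul_nsmul', hx]
  have hy' : (m * y) • f = 0 := by rw [mul_nsmul', hy]
  have hk : 0 < k := Nat.pos_of_mul_pos_right (h ▸ by positivity : 0 < k * l)
  have e1 := torTau_mul_right (x • e) m y f (by positivity) hm
    (by rw [mul_comm, mul_nsmul', hx, nsmul_zero]) hy' hx hy
  have e2 := torTau_mul_left e (m * y) x f (by positivity) (by positivity)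
    (by rw [mul_right_comm, mul_comm, mul_nsmul', hx', nsmul_zero])
    (by rw [mul_comm, mul_nsmul', hy', nsmul_zero])
    (by rw [mul_comm, mul_nsmul', hx, nsmul_zero]) hy'
  have e3 := torTau_mul_left e l k f (by positivity) hl
    (by rw [mul_comm, mul_nsmul', he, nsmul_zero]) (by rw [mul_comm, mul_nsmul', hf, nsmul_zero])
    (by rw [smul_comm, he, nsmul_zero]) hf
  have e4 := DFunLike.congr_fun (map_nsmul (torTauHom A C l hl) k ⟨e, he⟩) ⟨f, hf⟩
  rw [← e1, ← e2]
  refine Eq.trans ?_ (e3.trans e4)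
  congr 1
  rw [mul_right_comm, h, mul_comm]

theorem torTau_zsmul_zsmul (e : A) (f : C) (m : ℕ) (x y : ℤ) (l : ℕ) (k : ℤ) (hm : 0 < m)
    (hx : m • (x • e) = 0) (hy : m • (y • f) = 0) (hl : 0 < l) (he : l • e = 0)
    (hf : l • f = 0) (h : m * x * y = k * l) :
    torTau (x • e) m (y • f) hm hx hy = k • torTau e l f hl he hf := by
  -- For nonnegative multipliers, positivity of `l` forces `k` to be nonnegative. The remaining
  -- signs are pulled out of the symbol.
  have key : ∀ (x y : ℕ) (k : ℤ) (hx : m • ((x : ℤ) • e) = 0) (hy : m • ((y : ℤ) • f) = 0)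
      (_ : (m * x * y : ℤ) = k * l),
      torTau ((x : ℤ) • e) m ((y : ℤ) • f) hm hx hy = k • torTau e l f hl he hf := by
    intro x y k hx hy h
    have hk : 0 ≤ k := nonneg_of_mul_nonneg_left (h ▸ by positivity : 0 ≤ k * (l : ℤ))
      (by exact_mod_cast hl)
    lift k to ℕ using hk
    simp only [natCast_zsmul] at hx hy ⊢
    exact torTau_nsmul_nsmul e f m x y l k hm hx hy hl he hf (by exact_mod_cast h)
  obtain ⟨x, rfl | rfl⟩ := x.eq_nat_or_neg <;> obtain ⟨y, rfl | rfl⟩ := y.eq_nat_or_neg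
  · exact key x y k hx hy h
  · simp only [neg_smul] at hy ⊢
    rw [torTau_neg_right _ _ _ _ _ (by rwa [smul_neg, neg_eq_zero] at hy),
      key x y (-k) hx _ (by linarith), neg_smul, neg_neg]
  · simp only [neg_smul] at hx ⊢
    rw [torTau_neg_left _ _ _ _ (by rwa [smul_neg, neg_eq_zero] at hx),
      key x y (-k) _ hy (by linarith), neg_smul, neg_neg]
  · simp only [neg_smul] at hx hy ⊢
    rw [torTau_neg_left _ _ _ _ (by rwa [smul_neg, neg_eq_zero] at hx),
      torTau_neg_right _ _ _ _ _ (by rwa [smul_neg, neg_eq_zero] at hy),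
      key x y k _ _ (by linarith), neg_neg]

theorem TorsionProduct.induction {p : TorsionProduct A C → Prop}
    (tau : ∀ a m c hm ha hc, p (torTau a m c hm ha hc)) (add : ∀ s t, p s → p t → p (s + t))
    (neg : ∀ t, p t → p (-t)) (zero : p 0) (t : TorsionProduct A C) : p t := by
  induction t using QuotientAddGroup.induction_on with | H t => ?_
  induction t using FreeAbelianGroup.induction_on with
  | zero => exact zero
  | of s => exact tau s.a s.m s.c s.pos s.ha s.hc
  | neg s h => exact neg _ h
  | add s t hs ht => exact add _ _ hs ht

/-- The class of `τ_m(a, b)` in the exterior torsion square. -/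
def extTau (a : A) (m : ℕ) (b : A) (hm : 0 < m) (ha : m • a = 0) (hb : m • b = 0) :
    ExtTorSquare A :=
  QuotientAddGroup.mk (torTau a m b hm ha hb)

theorem extTau_self (a : A) (m : ℕ) (hm : 0 < m) (ha hb : m • a = 0) :
    extTau a m a hm ha hb = 0 :=
  (QuotientAddGroup.eq_zero_iff _).2 (AddSubgroup.subset_closure ⟨a, m, hm, ha, rfl⟩)

/-- Expand the vanishing class of $\tau_m(a+b,a+b)$. -/
theorem extTau_swap (a b : A) (m : ℕ) (hm : 0 < m) (ha : m • a = 0) (hb : m • b = 0) :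
    extTau b m a hm hb ha = -extTau a m b hm ha hb := by
  have hab : m • (a + b) = 0 := by rw [smul_add, ha, hb, add_zero]
  have h := extTau_self (a + b) m hm hab hab
  rw [extTau, torTau_add_left _ _ _ _ _ ha hb, torTau_add_right _ _ _ _ _ _ ha hb,
    torTau_add_right _ _ _ _ _ _ ha hb] at h
  change extTau a m a hm ha ha + extTau a m b hm ha hb
    + (extTau b m a hm hb ha + extTau b m b hm hb hb) = 0 at h
  rw [extTau_self, extTau_self, zero_add, add_zero, add_comm] at h
  exact eq_neg_of_add_eq_zero_left h

end TorCalculus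

/-- A sum with alternating terms `T i j` depends only on the antisymmetrization of its
coefficients. -/
theorem sum_sum_zsmul_of_alternating {ι M : Type*} [Fintype ι] [LinearOrder ι] [AddCommGroup M]
    (k : ι → ι → ℤ) (T : ι → ι → M) (h0 : ∀ i, T i i = 0) (hT : ∀ i j, T j i = -T i j) :
    ∑ i, ∑ j, k i j • T i j = ∑ i, ∑ j, if i < j then (k i j - k j i) • T i j else 0 := by
  have h1 : ∀ i j, k i j • T i j
      = (if i < j then k i j • T i j else 0) + (if j < i then k i j • T i j else 0) := by
    intro i j
    obtain h | rfl | h := lt_trichotomy i j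
    · simp [h, h.not_gt]
    · simp [h0]
    · simp [h, h.not_gt]
  calc ∑ i, ∑ j, k i j • T i j
      = (∑ i, ∑ j, if i < j then k i j • T i j else 0)
        + ∑ i, ∑ j, if j < i then k i j • T i j else 0 := by
        simp only [← Finset.sum_add_distrib, ← h1]
    _ = _ := by
        rw [Finset.sum_comm (f := fun i j => if j < i then k i j • T i j else 0)]
        simp only [← Finset.sum_add_distrib]
        refine Finset.sum_congr rfl fun i _ => Finset.sum_congr rfl fun j _ => ?_
        split_ifs
        · rw [hT i j, sub_smul, smul_neg, sub_eq_add_neg]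
        · rw [add_zero]

/-! ### Coordinates on the exterior torsion square -/

namespace AdaptedFamily

variable {V A : Type*} [AddCommGroup V] [AddCommGroup A] {q : V →+ A} {n : ℕ}
  (a : AdaptedFamily q n)

/-- The least common multiple of the orders of `q (e i)` and `q (e j)`. -/
def order (i j : Fin n) : ℕ := (a.d i).lcm (a.d j)

theorem order_smul_left (i j : Fin n) : a.order i j • q (a.e i) = 0 :=
  (a.nsmul_eq_zero_iff i _).2 (Nat.dvd_lcm_left _ _)

theorem order_smul_right (i j : Fin n) : a.order i j • q (a.e j) = 0 :=
  (a.nsmul_eq_zero_iff j _).2 (Nat.dvd_lcm_right _ _)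

/-- The generator of the exterior torsion square attached to a pair of indices. -/
def extGen (i j : Fin n) : ExtTorSquare A :=
  if h : 0 < a.order i j then
    extTau (q (a.e i)) (a.order i j) (q (a.e j)) h (a.order_smul_left i j) (a.order_smul_right i j)
  else 0

theorem extGen_self (i : Fin n) : a.extGen i i = 0 := by
  unfold extGen
  split_ifs
  · exact extTau_self _ _ _ _ _
  · rfl

theorem order_comm (i j : Fin n) : a.order j i = a.order i j := Nat.lcm_comm _ _

theorem extGen_swap (i j : Fin n) : a.extGen j i = -a.extGen i j := by
  unfold extGen
  simp only [a.order_comm i j]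
  split_ifs
  · exact extTau_swap _ _ _ _ _ _
  · rw [neg_zero]

/-- When $d_i$ and $d_j$ are nonzero, the hypothesis says $\gcd(d_i,d_j)\mid k$. It matches the
divisibility that quadratic maps detect on $R'\gamma_3(F)$. -/
theorem zsmul_extGen_eq_zero (i j : Fin n) (k : ℤ)
    (h : (a.d i * a.d j : ℤ) ∣ k * a.order i j) : k • a.extGen i j = 0 := by
  unfold extGen
  split_ifs with hl
  · obtain ⟨c, hc⟩ := h
    have hi : (a.d i : ℤ) • q (a.e i) = 0 := (a.zsmul_eq_zero_iff i _).2 dvd_rfl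
    have hj : ((a.d j : ℤ) * c) • q (a.e j) = 0 :=
      (a.zsmul_eq_zero_iff j _).2 (dvd_mul_right _ _)
    -- With $k\,l_{ij}=d_id_jc$, the multiple is $\tau_1(d_i\,qe_i,\;d_jc\,qe_j)$, whose left
    -- argument is zero.
    have := torTau_zsmul_zsmul (q (a.e i)) (q (a.e j)) 1 (a.d i) (a.d j * c) (a.order i j) k
      one_pos (by rw [one_smul, hi]) (by rw [one_smul, hj]) hl (a.order_smul_left i j)
      (a.order_smul_right i j) (by rw [hc]; push_cast; ring)
    simp only [hi, torTau_zero_left] at this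
    change QuotientAddGroup.mk (k • _) = _
    rw [← this]
    rfl
  · rw [smul_zero]

/-- Since $m\,q(v)=0$, each $d_i$ divides $m\varepsilon_i(v)$, and likewise for $w$. So $l_{ij}$
divides $m\varepsilon_i(v)\varepsilon_j(w)$, and the quotient is the coefficient of the $(i,j)$
generator. Recording the product itself, not only the expansion, is what links the coefficients to
values of quadratic maps. -/
theorem exists_extTau_eq {v w : V} (hv : v ∈ a.spanned) (hw : w ∈ a.spanned) (m : ℕ)
    (hm : 0 < m) (hv' : m • q v = 0) (hw' : m • q w = 0) :
    ∃ k : Fin n → Fin n → ℤ, (∀ i j, m * a.ε i v * a.ε j w = k i j * a.order i j) ∧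
      extTau (q v) m (q w) hm hv' hw' = ∑ i, ∑ j, k i j • a.extGen i j := by
  have hdvd : ∀ {v : V}, v ∈ a.spanned → m • q v = 0 → ∀ i, (a.d i : ℤ) ∣ m * a.ε i v := by
    intro v hv h i
    have := a.dvd_of_map_eq_zero (nsmul_mem hv m) (by rw [map_nsmul, h]) i
    rwa [map_nsmul, nsmul_eq_mul] at this
  have hk : ∀ i j, (a.order i j : ℤ) ∣ m * a.ε i v * a.ε j w := by
    intro i j
    refine Int.natCast_dvd.2 (Nat.lcm_dvd (Int.natCast_dvd.1 ((hdvd hv hv' i).mul_right _))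
      (Int.natCast_dvd.1 ?_))
    rw [mul_right_comm]
    exact (hdvd hw hw' j).mul_right _
  choose k hk using fun i j => (hk i j)
  have hk' : ∀ i j, m * a.ε i v * a.ε j w = k i j * a.order i j := fun i j => by
    rw [hk, mul_comm]
  refine ⟨k, hk', ?_⟩
  have hsmul : ∀ {v : V}, v ∈ a.spanned → m • q v = 0 → ∀ i, m • (a.ε i v • q (a.e i)) = 0 := by
    intro v hv h i
    rw [← natCast_zsmul, smul_smul, a.zsmul_eq_zero_iff]
    exact hdvd hv h i
  have hqv : ∀ {v : V}, v ∈ a.spanned → q v = ∑ i, a.ε i v • q (a.e i) := by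
    intro v hv
    conv_lhs => rw [← a.mem_spanned.1 hv]
    simp only [map_sum, map_zsmul]
  have hsum : extTau (q v) m (q w) hm hv' hw' = QuotientAddGroup.mk (∑ i, ∑ j,
      torTau (a.ε i v • q (a.e i)) m (a.ε j w • q (a.e j)) hm (hsmul hv hv' i)
        (hsmul hw hw' j)) := by
    rw [extTau]
    refine congrArg _ ?_
    rw [← torTau_sum _ _ _ _ _ _ (by rw [← hqv hv, hv']) (by rw [← hqv hw, hw'])]
    congr 1
    · exact hqv hv
    · exact hqv hw
  rw [hsum]
  change QuotientAddGroup.mk' (torDiagonal A) _ = _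
  simp only [map_sum]
  refine Finset.sum_congr rfl fun i _ => Finset.sum_congr rfl fun j _ => ?_
  unfold extGen
  split_ifs with hl
  · rw [torTau_zsmul_zsmul _ _ _ _ _ (a.order i j) (k i j) hm _ _ hl (a.order_smul_left i j)
      (a.order_smul_right i j) (hk' i j)]
    rfl
  -- If $l_{ij}=0$, then `extGen` takes its default value 0. The coefficient equation makes one of
  -- the two coordinates zero, so the symbol vanishes as well.
  · have h0 : a.ε i v = 0 ∨ a.ε j w = 0 := by
      have := hk' i j
      rw [Nat.eq_zero_of_not_pos hl, Nat.cast_zero, mul_zero, mul_assoc] at this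
      simpa [hm.ne'] using this
    rw [smul_zero]
    obtain h0 | h0 := h0
    · simp only [h0, zero_smul, torTau_zero_left]
      rfl
    · simp only [h0, zero_smul, torTau_zero_right]
      rfl

end AdaptedFamily

/-! ### Bilinear forms on the abelianization -/

section BilinearLift

variable {E M : Type*} [Group E] [AddCommGroup M]

/-- A function `E × E → M` that is additive in both arguments, as a bilinear form on `E_ab`. -/
def abLift₂ (f : E → E → M) (h₁ : ∀ x y z, f (x * y) z = f x z + f y z)
    (h₂ : ∀ x y z, f x (y * z) = f x y + f x z) :
    Additive (Abelianization E) →+ Additive (Abelianization E) →+ M :=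
  MonoidHom.toAdditiveLeft (Abelianization.lift (MonoidHom.mk'
    (fun x => Multiplicative.ofAdd (MonoidHom.toAdditiveLeft (Abelianization.lift
      (MonoidHom.mk' (fun y => Multiplicative.ofAdd (f x y)) fun y z => h₂ x y z))))
    fun x y => congrArg Multiplicative.ofAdd (AddMonoidHom.ext fun b => by
      obtain ⟨z, rfl⟩ := abClass_surjective b
      exact h₁ x y z)))

end BilinearLift

/-! ### The commutators `[x ^ m, y]` in the relative dimension subgroup -/

section AugForm

variable {E : Type u} [Group E] {N : Subgroup E}

-- Since $xy-1-(x-1)-(y-1)=(x-1)(y-1)$, these triple products are the defects of additivity of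
-- $(x-1)(y-1)$ in either variable.
variable (N) in
theorem of_sub_one_mul_mem_relDimIdeal (x y z : E) :
    (MonoidAlgebra.of ℤ E x - 1) * (MonoidAlgebra.of ℤ E y - 1) * (MonoidAlgebra.of ℤ E z - 1)
      ∈ relDimIdeal N 3 := by
  refine Ideal.mem_sup_right ?_
  rw [Submodule.pow_succ, Submodule.pow_succ, Submodule.pow_one]
  exact Ideal.mul_mem_mul (Ideal.mul_mem_mul (of_sub_one_mem_augIdeal _)
    (of_sub_one_mem_augIdeal _)) (of_sub_one_mem_augIdeal _)

variable (N) in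
/-- The bilinear form `(x, y) ↦ (x - 1) (y - 1)` with values in `ℤ[E] / (𝔫 𝔢 + 𝔢³)`. -/
noncomputable def augForm : Additive (Abelianization E) →+ Additive (Abelianization E) →+
    MonoidAlgebra ℤ E ⧸ relDimIdeal N 3 :=
  abLift₂ (fun x y => Ideal.Quotient.mk (relDimIdeal N 3)
      ((MonoidAlgebra.of ℤ E x - 1) * (MonoidAlgebra.of ℤ E y - 1)))
    (fun x y z => by
      rw [← map_add, Ideal.Quotient.mk_eq_mk_iff_sub_mem]
      convert of_sub_one_mul_mem_relDimIdeal N x y z using 1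
      rw [map_mul]
      noncomm_ring)
    (fun x y z => by
      rw [← map_add, Ideal.Quotient.mk_eq_mk_iff_sub_mem]
      convert of_sub_one_mul_mem_relDimIdeal N x y z using 1
      rw [map_mul]
      noncomm_ring)

theorem augForm_apply (x y : E) : augForm N (abClass x) (abClass y) =
    Ideal.Quotient.mk (relDimIdeal N 3)
      ((MonoidAlgebra.of ℤ E x - 1) * (MonoidAlgebra.of ℤ E y - 1)) := rfl

theorem isQuadraticMap_augForm : IsQuadraticMap (augForm N)
    fun x => Ideal.Quotient.mk (relDimIdeal N 3) (MonoidAlgebra.of ℤ E x - 1) := fun x y => by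
  beta_reduce
  rw [augForm_apply, ← map_add, ← map_add, map_mul]
  congr 1
  noncomm_ring

theorem augForm_eq_zero {x : E} (hx : x ∈ derivedSup N) : augForm N (abClass x) = 0 := by
  obtain ⟨r, hr, e, he, rfl⟩ := Subgroup.mem_sup_of_normal_right.1 hx
  rw [abClass_mul, abClass_eq_zero.2 he, add_zero]
  refine AddMonoidHom.ext fun b => ?_
  obtain ⟨y, rfl⟩ := abClass_surjective b
  exact Ideal.Quotient.eq_zero_iff_mem.2 (Ideal.mem_sup_left
    (Ideal.mul_mem_mul (of_sub_one_mem_subAugIdeal hr) (of_sub_one_mem_augIdeal y)))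

/-- Modulo the ideal, $[x^m,y]-1$ is $(x^m-1)(y-1)-(y-1)(x^m-1)$. The first product is zero because
$x^m\in NE'$. By bilinearity the second is $(y^m-1)(x-1)$, which is zero because $y^m\in NE'$. -/
theorem commutator_pow_mem_relDimSubgroup {x y : E} {m : ℕ} (hx : x ^ m ∈ derivedSup N)
    (hy : y ^ m ∈ derivedSup N) : ⁅x ^ m, y⁆ ∈ relDimSubgroup N 3 := by
  refine Ideal.Quotient.eq_zero_iff_mem.1
    ((isQuadraticMap_augForm.map_commutatorElement (x ^ m) y).trans ?_)
  have h : augForm N (abClass y) (abClass (x ^ m)) = augForm N (abClass (y ^ m)) (abClass x) := by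
    rw [abClass_pow, abClass_pow, map_nsmul, map_nsmul, AddMonoidHom.nsmul_apply]
  rw [h, augForm_eq_zero hx, augForm_eq_zero hy]
  simp

end AugForm

/-! ### The image of `[ , ] ω₁` -/

section TorComm

open scoped IsMulCommutative

variable {E : Type u} [Group E] (N : Subgroup E) [N.Normal]

/-- The composite of `[ , ] ω₁` with the inclusion into `E / N' γ₃(E)`. -/
noncomputable def torComm :
    TorsionProduct (AbQuot N) (AbQuot N) →+ Additive (E ⧸ relGammaThree N) :=
  (MonoidHom.toAdditive (SubQuot.incl (N ⊔ gammaThree E) (relGammaThree N))).comp (commOmegaOne N)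

variable {N}

theorem nsmul_derivedQuotProj_eq_zero {x : E} {m : ℕ} :
    m • derivedQuotProj N (abClass x) = 0 ↔ x ^ m ∈ derivedSup N :=
  QuotientGroup.eq_one_iff (x ^ m)

theorem torComm_tau (x : E) (m : ℕ) (y : E) (hm : 0 < m)
    (hx : m • derivedQuotProj N (abClass x) = 0) (hy : m • derivedQuotProj N (abClass y) = 0) :
    torComm N (torTau (derivedQuotProj N (abClass x)) m (derivedQuotProj N (abClass y)) hm hx hy)
      = Additive.ofMul (QuotientGroup.mk ⁅x ^ m, y⁆) := by
  have h : omegaOne N (torTau (derivedQuotProj N (abClass x)) m (derivedQuotProj N (abClass y))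
      hm hx hy) = (Additive.ofMul (QuotientGroup.mk
        ⟨x ^ m, nsmul_derivedQuotProj_eq_zero.1 hx⟩) : DerivedQuot N) ⊗ₜ[ℤ]
          (Additive.ofMul (QuotientGroup.mk y) : AbQuot N) :=
    torConnecting_tau _ _ _ _ _ _ _ _ _ _ _ (abClass x) rfl _ rfl
  rw [torComm, commOmegaOne, AddMonoidHom.comp_apply, AddMonoidHom.comp_apply, h, commHom_tmul]
  rfl

theorem torDiagonal_le_ker_torComm : torDiagonal (AbQuot N) ≤ (torComm N).ker := by
  refine (AddSubgroup.closure_le _).2 ?_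
  rintro _ ⟨x, m, hm, hx, rfl⟩
  obtain ⟨x, rfl⟩ := derivedQuotProj_surjective N x
  obtain ⟨x, rfl⟩ := abClass_surjective x
  change torComm N _ = 0
  rw [torComm_tau, commutatorElement_eq_one_iff_commute.2 (Commute.pow_self x m)]
  rfl

variable (N) in
/-- Commutation in `E` as a bilinear form on `E_ab` with values in the centre of
`E / N' γ₃(E)`. -/
def commForm : Additive (Abelianization E) →+ Additive (Abelianization E) →+
    Additive (Subgroup.center (E ⧸ relGammaThree N)) :=
  -- The full quotient $E/N'\gamma_3(E)$ need not be abelian; commutators are central in it because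
  -- $\gamma_3(E)$ is killed, so the centre is a valid target for a bilinear form.
  abLift₂ (fun x y => Additive.ofMul ⟨QuotientGroup.mk ⁅x, y⁆, by
      rw [Subgroup.mem_center_iff]
      intro g
      induction g using QuotientGroup.induction_on with | H g => ?_
      have := conj_commutator_eq N (mem_commutator_commutatorElement x y) g
      rwa [QuotientGroup.mk_mul, QuotientGroup.mk_mul, QuotientGroup.mk_inv,
        mul_inv_eq_iff_eq_mul] at this⟩)
    (fun x y z => by
      rw [add_comm, ← ofMul_mul]
      refine congrArg Additive.ofMul (Subtype.ext ?_)
      change (QuotientGroup.mk ⁅x * y, z⁆ : E ⧸ relGammaThree N)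
        = QuotientGroup.mk ⁅y, z⁆ * QuotientGroup.mk ⁅x, z⁆
      rw [commutatorElement_mul_left_eq_conj_mul, QuotientGroup.mk_mul,
        conj_commutator_eq N (mem_commutator_commutatorElement _ _)])
    (fun x y z => by
      rw [← ofMul_mul]
      refine congrArg Additive.ofMul (Subtype.ext ?_)
      change (QuotientGroup.mk ⁅x, y * z⁆ : E ⧸ relGammaThree N)
        = QuotientGroup.mk ⁅x, y⁆ * QuotientGroup.mk ⁅x, z⁆
      have h : ⁅x, y * z⁆ = ⁅x, y⁆ * (y * ⁅x, z⁆ * y⁻¹) := by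
        rw [commutatorElement_mul_right_eq_mul_conj]; simp only [mul_assoc]
      rw [h, QuotientGroup.mk_mul, conj_commutator_eq N (mem_commutator_commutatorElement _ _)])

/-- The inclusion of the centre of a group, written additively. -/
def centerIncl (G : Type*) [Group G] : Additive (Subgroup.center G) →+ Additive G :=
  MonoidHom.toAdditive (Subgroup.center G).subtype

theorem centerIncl_commForm (x y : E) : centerIncl _ (commForm N (abClass x) (abClass y))
    = Additive.ofMul (QuotientGroup.mk ⁅x, y⁆) := rfl

theorem commForm_self (v : Additive (Abelianization E)) : commForm N v v = 0 := by
  obtain ⟨x, rfl⟩ := abClass_surjective v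
  refine congrArg Additive.ofMul (Subtype.ext ?_)
  change (QuotientGroup.mk ⁅x, x⁆ : E ⧸ relGammaThree N) = 1
  rw [commutatorElement_self]
  rfl

theorem commForm_swap (v w : Additive (Abelianization E)) :
    commForm N w v = -commForm N v w := by
  have h := commForm_self (N := N) (v + w)
  simp only [map_add, AddMonoidHom.add_apply, commForm_self, zero_add, add_zero] at h
  exact eq_neg_of_add_eq_zero_right (by rw [add_comm]; exact h)

end TorComm

/-! ### The kernel and the range for free groups -/

section FreeGroups

open scoped IsMulCommutative

theorem IsFreeGroup.free_abelianization (F : Type*) [Group F] [IsFreeGroup F] :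
    Module.Free ℤ (Additive (Abelianization F)) := by
  have e : FreeAbelianGroup (IsFreeGroup.Generators F) ≃+ Additive (Abelianization F) :=
    MulEquiv.toAdditive (MulEquiv.abelianizationCongr (IsFreeGroup.mulEquiv F))
  exact Module.Free.of_basis ((FreeAbelianGroup.basis _).map e.toIntLinearEquiv)

/-! ### Bilinear forms attached to an adapted family -/

namespace AdaptedFamily

variable {V A M : Type*} [AddCommGroup V] [AddCommGroup A] [AddCommGroup M] {q : V →+ A} {n : ℕ}
  (a : AdaptedFamily q n)

/-- The bilinear form `(v, w) ↦ ε i v * ε j w`. -/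
def coordForm (i j : Fin n) : V →+ V →+ ℤ :=
  (AddMonoidHom.mul.comp (a.ε i)).compl₂ (a.ε j)

theorem coordForm_apply (i j : Fin n) (v w : V) : a.coordForm i j v w = a.ε i v * a.ε j w := rfl

/-- The bilinear form `(v, w) ↦ ε j w • q v`. -/
def rightCoordForm (j : Fin n) : V →+ V →+ A :=
  (AddMonoidHom.mk' (fun v => AddMonoidHom.mk' (fun w => a.ε j w • q v)
      fun w w' => by rw [map_add, add_smul])
    fun v v' => AddMonoidHom.ext fun w => by simp)

theorem rightCoordForm_apply (j : Fin n) (v w : V) :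
    a.rightCoordForm j v w = a.ε j w • q v := rfl

theorem map₂_eq_sum (B : V →+ V →+ M) {v w : V} (hv : v ∈ a.spanned) (hw : w ∈ a.spanned) :
    B v w = ∑ i, ∑ j, (a.ε i v * a.ε j w) • B (a.e i) (a.e j) := by
  conv_lhs => rw [← a.mem_spanned.1 hv, ← a.mem_spanned.1 hw]
  simp only [map_sum, map_zsmul, AddMonoidHom.finsetSum_apply, AddMonoidHom.smul_apply, mul_smul,
    Finset.smul_sum]
  rw [Finset.sum_comm]
  exact Finset.sum_congr rfl fun i _ => Finset.sum_congr rfl fun j _ => smul_comm _ _ _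

end AdaptedFamily

variable {F : Type u} [Group F] {R : Subgroup F} [R.Normal]

/-- The representative `f` and the finite set `S` are fixed before the family. One family can then
serve both `t` and an expression of `f` as an element of $R'\gamma_3(F)$. Only the antisymmetrised
coefficients are visible to `c`, and they are all that matters in the exterior square. -/
theorem exists_coordForm_eq (t : TorsionProduct (AbQuot R) (AbQuot R)) :
    ∃ f ∈ commutator F, torComm R t = Additive.ofMul (QuotientGroup.mk f) ∧
      ∃ S : Set (Additive (Abelianization F)), S.Finite ∧
        ∀ (n : ℕ) (a : AdaptedFamily (derivedQuotProj R) n), S ⊆ a.spanned →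
          ∃ k : Fin n → Fin n → ℤ,
            (QuotientAddGroup.mk t : ExtTorSquare (AbQuot R))
              = ∑ i, ∑ j, k i j • a.extGen i j ∧
            ∀ i j c, IsQuadraticMap (a.coordForm i j) c →
              c f = (k i j - k j i) * a.order i j := by
  induction t using TorsionProduct.induction with
  | tau v m w hm hv hw =>
    obtain ⟨v, rfl⟩ := derivedQuotProj_surjective R v
    obtain ⟨x, rfl⟩ := abClass_surjective v
    obtain ⟨w, rfl⟩ := derivedQuotProj_surjective R w
    obtain ⟨y, rfl⟩ := abClass_surjective w
    refine ⟨_, mem_commutator_commutatorElement (x ^ m) y, torComm_tau x m y hm hv hw,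
      {abClass x, abClass y}, Set.toFinite _, fun n a ha => ?_⟩
    obtain ⟨k, hk, hk'⟩ := a.exists_extTau_eq (ha (Set.mem_insert _ _))
      (ha (Set.mem_insert_of_mem _ rfl)) m hm hv hw
    refine ⟨k, hk', fun i j c hc => ?_⟩
    -- $c([x^m,y])=m\varepsilon_i(x)\varepsilon_j(y)-m\varepsilon_i(y)\varepsilon_j(x)$; the two
    -- terms are $k_{ij}l_{ij}$ and $k_{ji}l_{ji}$, and $l$ is symmetric.
    rw [hc.map_commutatorElement, a.coordForm_apply, a.coordForm_apply, abClass_pow, map_nsmul,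
      map_nsmul, nsmul_eq_mul, nsmul_eq_mul, sub_mul, ← hk, ← a.order_comm, ← hk]
    ring
  | add s t hs ht =>
    obtain ⟨f, hf, hsf, S, hS, hS'⟩ := hs
    obtain ⟨g, hg, htg, T, hT, hT'⟩ := ht
    refine ⟨f * g, mul_mem hf hg, by rw [map_add, hsf, htg]; rfl, S ∪ T, hS.union hT,
      fun n a ha => ?_⟩
    obtain ⟨k, hk, hk'⟩ := hS' n a (Set.subset_union_left.trans ha)
    obtain ⟨l, hl, hl'⟩ := hT' n a (Set.subset_union_right.trans ha)
    refine ⟨k + l, ?_, fun i j c hc => ?_⟩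
    · rw [QuotientAddGroup.mk_add, hk, hl]
      simp only [Pi.add_apply, add_zsmul, Finset.sum_add_distrib]
    · rw [hc.map_mul_of_mem hf, hk' i j c hc, hl' i j c hc]
      simp only [Pi.add_apply]
      ring
  | neg t ht =>
    obtain ⟨f, hf, hsf, S, hS, hS'⟩ := ht
    refine ⟨f⁻¹, inv_mem hf, by rw [map_neg, hsf]; rfl, S, hS, fun n a ha => ?_⟩
    obtain ⟨k, hk, hk'⟩ := hS' n a ha
    refine ⟨-k, ?_, fun i j c hc => ?_⟩
    · rw [QuotientAddGroup.mk_neg, hk]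
      simp only [Pi.neg_apply, neg_smul, Finset.sum_neg_distrib]
    · rw [hc.map_inv_of_mem hf, hk' i j c hc]
      simp only [Pi.neg_apply]
      ring
  | zero =>
    refine ⟨1, one_mem _, by rw [map_zero]; rfl, ∅, Set.finite_empty, fun n a _ =>
      ⟨0, ?_, fun i j c hc => ?_⟩⟩
    · simp
    · rw [hc.map_one]
      simp

/-- For $r,s\in R$ in the span, $d_i$ divides the $i$-th coordinate of each, so both terms of
$c([r,s])$ are divisible by $d_id_j$. The factor from $\gamma_3(F)$ contributes nothing. -/
theorem exists_dvd_of_mem_relGammaThree {f : F} (hf : f ∈ relGammaThree R) :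
    ∃ S : Set (Additive (Abelianization F)), S.Finite ∧
      ∀ (n : ℕ) (a : AdaptedFamily (derivedQuotProj R) n), S ⊆ a.spanned →
        ∀ i j c, IsQuadraticMap (a.coordForm i j) c → (a.d i * a.d j : ℤ) ∣ c f := by
  obtain ⟨r, hr, g, hg, rfl⟩ := Subgroup.mem_sup_of_normal_right.1 hf
  have key : r ∈ commutator F ∧ ∃ S : Set (Additive (Abelianization F)), S.Finite ∧
      ∀ (n : ℕ) (a : AdaptedFamily (derivedQuotProj R) n), S ⊆ a.spanned →
        ∀ i j c, IsQuadraticMap (a.coordForm i j) c → (a.d i * a.d j : ℤ) ∣ c r := by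
    clear hf
    rw [Subgroup.commutator_def] at hr
    induction hr using Subgroup.closure_induction with
    | mem r hr =>
      obtain ⟨x, hx, y, hy, rfl⟩ := hr
      refine ⟨mem_commutator_commutatorElement x y, {abClass x, abClass y}, Set.toFinite _,
        fun n a ha i j c hc => ?_⟩
      have hker : ∀ {z : F}, z ∈ R → derivedQuotProj R (abClass z) = 0 := fun hz =>
        (QuotientGroup.eq_one_iff _).2 (Subgroup.mem_sup_left hz)
      have hxd := a.dvd_of_map_eq_zero (ha (Set.mem_insert _ _)) (hker hx)
      have hyd := a.dvd_of_map_eq_zero (ha (Set.mem_insert_of_mem _ rfl)) (hker hy)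
      rw [hc.map_commutatorElement, a.coordForm_apply, a.coordForm_apply]
      exact dvd_sub (mul_dvd_mul (hxd i) (hyd j)) (mul_dvd_mul (hyd i) (hxd j))
    | one =>
      refine ⟨one_mem _, ∅, Set.finite_empty, fun n a _ i j c hc => ?_⟩
      rw [hc.map_one]
      exact dvd_zero _
    | mul x y _ _ hx hy =>
      obtain ⟨hx, S, hS, hS'⟩ := hx
      obtain ⟨hy, T, hT, hT'⟩ := hy
      refine ⟨mul_mem hx hy, S ∪ T, hS.union hT, fun n a ha i j c hc => ?_⟩
      rw [hc.map_mul_of_mem hx]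
      exact dvd_add (hS' n a (Set.subset_union_left.trans ha) i j c hc)
        (hT' n a (Set.subset_union_right.trans ha) i j c hc)
    | inv x _ hx =>
      obtain ⟨hx, S, hS, hS'⟩ := hx
      refine ⟨inv_mem hx, S, hS, fun n a ha i j c hc => ?_⟩
      rw [hc.map_inv_of_mem hx, dvd_neg]
      exact hS' n a ha i j c hc
  obtain ⟨hr, S, hS, hS'⟩ := key
  refine ⟨S, hS, fun n a ha i j c hc => ?_⟩
  rw [hc.map_mul_of_mem hr, hc.map_eq_zero_of_mem_gammaThree hg, add_zero]
  exact hS' n a ha i j c hc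

theorem ker_torComm [IsFreeGroup F] : (torComm R).ker = torDiagonal (AbQuot R) := by
  refine le_antisymm (fun t ht => ?_) torDiagonal_le_ker_torComm
  obtain ⟨f, hf, hft, S, hS, hS'⟩ := exists_coordForm_eq t
  have hfR : f ∈ relGammaThree R := by
    rw [AddMonoidHom.mem_ker.1 ht] at hft
    exact (QuotientGroup.eq_one_iff f).1 hft.symm
  obtain ⟨T, hT, hT'⟩ := exists_dvd_of_mem_relGammaThree hfR
  have := IsFreeGroup.free_abelianization F
  obtain ⟨n, a, ha⟩ := AdaptedFamily.exists_spanned (derivedQuotProj R) (hS.union hT)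
  obtain ⟨k, hk, hk'⟩ := hS' n a (Set.subset_union_left.trans ha)
  rw [← QuotientAddGroup.eq_zero_iff, hk,
    sum_sum_zsmul_of_alternating k a.extGen a.extGen_self a.extGen_swap]
  refine Finset.sum_eq_zero fun i _ => Finset.sum_eq_zero fun j _ => ?_
  split_ifs
  -- One number $c(f)$ is computed twice: from `t` it is $(k_{ij}-k_{ji})l_{ij}$, and from $f\in
  -- R'\gamma_3(F)$ it is a multiple of $d_id_j$.
  · obtain ⟨c, hc⟩ := IsFreeGroup.exists_isQuadraticMap (a.coordForm i j)
    refine a.zsmul_extGen_eq_zero i j _ ?_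
    rw [← hk' i j c hc]
    exact hT' n a (Set.subset_union_right.trans ha) i j c hc
  · rfl

/-- The same coefficients express `f` modulo $R'\gamma_3(F)$ and compute every $M$-valued quadratic
map at `f`. So constraints found by quadratic maps become statements about that expression. -/
theorem exists_commForm_eq (M : Type*) [AddCommGroup M] {f : F} (hf : f ∈ commutator F) :
    ∃ S : Set (Additive (Abelianization F)), S.Finite ∧
      ∀ (n : ℕ) (a : AdaptedFamily (derivedQuotProj R) n), S ⊆ a.spanned →
        ∃ k : Fin n → Fin n → ℤ,
          (Additive.ofMul (QuotientGroup.mk f) : Additive (F ⧸ relGammaThree R))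
            = centerIncl _ (∑ i, ∑ j, k i j • commForm R (a.e i) (a.e j)) ∧
          ∀ (B : Additive (Abelianization F) →+ Additive (Abelianization F) →+ M) (c : F → M),
            IsQuadraticMap B c →
              c f = ∑ i, ∑ j, k i j • (B (a.e i) (a.e j) - B (a.e j) (a.e i)) := by
  unfold commutator at hf
  rw [Subgroup.commutator_def] at hf
  induction hf using Subgroup.closure_induction with
  | mem f hf =>
    obtain ⟨x, -, y, -, rfl⟩ := hf
    refine ⟨{abClass x, abClass y}, Set.toFinite _, fun n a ha =>
      ⟨fun i j => a.ε i (abClass x) * a.ε j (abClass y), ?_, fun B c hc => ?_⟩⟩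
    all_goals
      have hx := ha (Set.mem_insert _ _)
      have hy := ha (Set.mem_insert_of_mem _ rfl)
    · rw [← a.map₂_eq_sum _ hx hy, centerIncl_commForm]
    · rw [hc.map_commutatorElement, a.map₂_eq_sum _ hx hy]
      have := a.map₂_eq_sum B.flip hx hy
      simp only [AddMonoidHom.flip_apply] at this
      rw [this]
      simp only [smul_sub, Finset.sum_sub_distrib]
  | one =>
    refine ⟨∅, Set.finite_empty, fun n a _ => ⟨0, ?_, fun B c hc => ?_⟩⟩
    · simp only [Pi.zero_apply, zero_smul, Finset.sum_const_zero, map_zero]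
      rfl
    · rw [hc.map_one]
      simp
  | mul x y hx hy ihx ihy =>
    obtain ⟨S, hS, hS'⟩ := ihx
    obtain ⟨T, hT, hT'⟩ := ihy
    refine ⟨S ∪ T, hS.union hT, fun n a ha => ?_⟩
    obtain ⟨k, hk, hk'⟩ := hS' n a (Set.subset_union_left.trans ha)
    obtain ⟨l, hl, hl'⟩ := hT' n a (Set.subset_union_right.trans ha)
    refine ⟨k + l, ?_, fun B c hc => ?_⟩
    · rw [QuotientGroup.mk_mul, ofMul_mul, hk, hl, ← map_add]
      simp only [Pi.add_apply, add_zsmul, Finset.sum_add_distrib]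
    · rw [← Subgroup.commutator_def, ← commutator_def] at hx
      rw [hc.map_mul_of_mem hx, hk' B c hc, hl' B c hc]
      simp only [Pi.add_apply, add_zsmul, Finset.sum_add_distrib]
  | inv x hx ihx =>
    obtain ⟨S, hS, hS'⟩ := ihx
    refine ⟨S, hS, fun n a ha => ?_⟩
    obtain ⟨k, hk, hk'⟩ := hS' n a ha
    refine ⟨-k, ?_, fun B c hc => ?_⟩
    · rw [QuotientGroup.mk_inv, ofMul_inv, hk, ← map_neg]
      simp only [Pi.neg_apply, neg_smul, Finset.sum_neg_distrib]
    · rw [← Subgroup.commutator_def, ← commutator_def] at hx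
      rw [hc.map_inv_of_mem hx, hk' B c hc]
      simp only [Pi.neg_apply, neg_smul, Finset.sum_neg_distrib]

theorem centerIncl_zsmul_commForm_mem_range {v w : Additive (Abelianization F)} {k : ℤ}
    (hv : k • derivedQuotProj R v = 0) (hw : k • derivedQuotProj R w = 0) :
    centerIncl _ (k • commForm R v w) ∈ (torComm R).range := by
  obtain ⟨x, rfl⟩ := abClass_surjective v
  obtain ⟨y, rfl⟩ := abClass_surjective w
  have key : ∀ m : ℕ, m • derivedQuotProj R (abClass x) = 0 →
      m • derivedQuotProj R (abClass y) = 0 →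
      centerIncl _ (m • commForm R (abClass x) (abClass y)) ∈ (torComm R).range := by
    intro m hx hy
    -- No symbol $\tau_0$ exists, but the zeroth multiple is trivially in the range.
    obtain rfl | hm := m.eq_zero_or_pos
    · rw [zero_smul, map_zero]
      exact zero_mem _
    · refine ⟨_, (torComm_tau x m y hm hx hy).trans ?_⟩
      rw [← centerIncl_commForm, abClass_pow, map_nsmul, AddMonoidHom.nsmul_apply]
  obtain ⟨m, rfl | rfl⟩ := k.eq_nat_or_neg
  · rw [natCast_zsmul] at hv hw ⊢
    exact key m hv hw
  · rw [neg_smul, natCast_zsmul, neg_eq_zero] at hv hw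
    rw [neg_smul, natCast_zsmul, map_neg]
    exact neg_mem (key m hv hw)

/-- Quadratic maps with values in $A$ itself force $k_{ij}-k_{ji}$ to be divisible by $d_i$, and by
antisymmetry also by $d_j$. That is exactly what makes the corresponding symbol defined. -/
theorem mem_range_torComm [IsFreeGroup F] {f : F} (hf : f ∈ relDimSubgroup R 3) :
    Additive.ofMul (QuotientGroup.mk f : F ⧸ relGammaThree R) ∈ (torComm R).range := by
  obtain ⟨S, hS, hS'⟩ := exists_commForm_eq (R := R) (AbQuot R)
    (relDimSubgroup_three_le_commutator R hf)
  have := IsFreeGroup.free_abelianization F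
  obtain ⟨n, a, ha⟩ := AdaptedFamily.exists_spanned (derivedQuotProj R) hS
  obtain ⟨k, hk, hk'⟩ := hS' n a ha
  have hdvd : ∀ i j, (a.d i : ℤ) ∣ k i j - k j i := by
    intro i j
    -- This form vanishes on $R\times F$ because `q` kills $R$, so `c` kills $D_3(F,R)$. Pairing
    -- with $\varepsilon_j$ isolates the $j$-th column $\sum_i(k_{ij}-k_{ji})q(e_i)$.
    obtain ⟨c, hc⟩ := IsFreeGroup.exists_isQuadraticMap (a.rightCoordForm j)
    have h0 : c f = 0 := by
      refine hc.map_eq_zero_of_mem_relDimSubgroup (fun r hr => ?_) hf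
      have hr' : derivedQuotProj R (abClass r) = 0 :=
        (QuotientGroup.eq_one_iff _).2 (Subgroup.mem_sup_left hr)
      refine AddMonoidHom.ext fun w => ?_
      rw [a.rightCoordForm_apply, hr', smul_zero, AddMonoidHom.zero_apply]
    refine (a.map_sum_eq_zero_iff fun i => k i j - k j i).1 ?_ i
    rw [← h0, hk' _ c hc]
    simp only [a.rightCoordForm_apply, a.ε_e, smul_sub, Finset.sum_sub_distrib, sub_smul, map_sub,
      map_sum, map_zsmul, ite_smul, one_smul, zero_smul, smul_ite, smul_zero]
    simp
  rw [hk, sum_sum_zsmul_of_alternating k _ (fun i => commForm_self _)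
    fun i j => commForm_swap _ _]
  change _ ∈ (torComm R).range.comap (centerIncl _)
  refine sum_mem fun i _ => sum_mem fun j _ => ?_
  split_ifs
  · refine centerIncl_zsmul_commForm_mem_range ((a.zsmul_eq_zero_iff _ _).2 (hdvd i j))
      ((a.zsmul_eq_zero_iff _ _).2 ?_)
    rw [← dvd_neg, neg_sub]
    exact hdvd j i
  · exact zero_mem _

variable (R) in
/-- The inclusion of `D₃(F, R) / R' γ₃(F)` into `F / R' γ₃(F)`, written additively. -/
noncomputable def relDimIncl : Additive (RelDimQuot R) →+ Additive (F ⧸ relGammaThree R) :=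
  MonoidHom.toAdditive (SubQuot.incl (relDimSubgroup R 3) (relGammaThree R))

theorem relDimIncl_injective : Function.Injective (relDimIncl R) :=
  SubQuot.incl_injective (relDimSubgroup R 3) (relGammaThree R)

theorem range_torComm [IsFreeGroup F] : (torComm R).range = (relDimIncl R).range := by
  refine le_antisymm ?_ ?_
  · rintro _ ⟨t, rfl⟩
    induction t using TorsionProduct.induction with
    | tau v m w hm hv hw =>
      obtain ⟨v, rfl⟩ := derivedQuotProj_surjective R v
      obtain ⟨x, rfl⟩ := abClass_surjective v
      obtain ⟨w, rfl⟩ := derivedQuotProj_surjective R w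
      obtain ⟨y, rfl⟩ := abClass_surjective w
      rw [torComm_tau]
      exact ⟨Additive.ofMul (QuotientGroup.mk ⟨_, commutator_pow_mem_relDimSubgroup
        (nsmul_derivedQuotProj_eq_zero.1 hv) (nsmul_derivedQuotProj_eq_zero.1 hw)⟩), rfl⟩
    | add s t hs ht => rw [map_add]; exact add_mem hs ht
    | neg t ht => rw [map_neg]; exact neg_mem ht
    | zero => rw [map_zero]; exact zero_mem _
  · rintro _ ⟨z, rfl⟩
    induction z using Additive.rec with | ofMul z => ?_
    induction z using QuotientGroup.induction_on with | H f => ?_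
    exact mem_range_torComm f.2

variable (R) in
/-- The isomorphism `F_ab(R) ∧* F_ab(R) ≅ D₃(F, R) / R' γ₃(F)` induced by `[ , ] ω₁`, where
`F_ab(R) = F / R F'`. -/
noncomputable def extTorSquareEquiv [IsFreeGroup F] :
    ExtTorSquare (AbQuot R) ≃+ Additive (RelDimQuot R) :=
  (QuotientAddGroup.quotientAddEquivOfEq ker_torComm.symm).trans
    ((QuotientAddGroup.quotientKerEquivRange (torComm R)).trans
      ((AddEquiv.addSubgroupCongr range_torComm).trans
        (AddMonoidHom.ofInjective relDimIncl_injective).symm))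

theorem relDimIncl_extTorSquareEquiv [IsFreeGroup F]
    (t : TorsionProduct (AbQuot R) (AbQuot R)) :
    relDimIncl R (extTorSquareEquiv R (QuotientAddGroup.mk t)) = torComm R t := by
  have h := AddMonoidHom.apply_ofInjective_symm (relDimIncl_injective (R := R))
    (AddEquiv.addSubgroupCongr range_torComm
      (QuotientAddGroup.quotientKerEquivRange (torComm R) (QuotientAddGroup.mk t)))
  exact h

/-- On symbols both sides are the class of $[\varphi(x)^m,\varphi(y)]$; freeness plays no role. -/
theorem torComm_map {F₂ : Type u} [Group F₂] (R₂ : Subgroup F₂) [R₂.Normal] (φ : F →* F₂)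
    (h : R ≤ (derivedSup R₂).comap φ) (t : TorsionProduct (AbQuot R) (AbQuot R)) :
    torComm R₂ (TorsionProduct.map (AbQuot.map R R₂ φ h) (AbQuot.map R R₂ φ h) t)
      = MonoidHom.toAdditive (QuotientGroup.map (relGammaThree R) (relGammaThree R₂) φ
          (relGammaThree_le_comap R R₂ φ h)) (torComm R t) := by
  induction t using TorsionProduct.induction with
  | tau v m w hm hv hw =>
    obtain ⟨v, rfl⟩ := derivedQuotProj_surjective R v
    obtain ⟨x, rfl⟩ := abClass_surjective v
    obtain ⟨w, rfl⟩ := derivedQuotProj_surjective R w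
    obtain ⟨y, rfl⟩ := abClass_surjective w
    rw [torComm_tau, TorsionProduct.map_tau]
    refine (torComm_tau (φ x) m (φ y) hm _ _).trans ?_
    rw [← map_pow, ← map_commutatorElement]
    rfl
  | add s t hs ht => rw [map_add, map_add, map_add, hs, ht, ← map_add]
  | neg t ht => rw [map_neg, map_neg, map_neg, ht, ← map_neg]
  | zero => rw [map_zero, map_zero, map_zero, map_zero]

end FreeGroups

/-! ### The isomorphism and its naturality -/

theorem mainTheorem1 :
    ∃ Φ : ∀ (F : Type u) [Group F] [IsFreeGroup F] (R : Subgroup F) [R.Normal],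
        ExtTorSquare (AbQuot R) ≃+ Additive (RelDimQuot R),
      (∀ (F : Type u) [Group F] [IsFreeGroup F] (R : Subgroup F) [R.Normal]
        (t : TorsionProduct (AbQuot R) (AbQuot R)),
        SubQuot.incl (relDimSubgroup R 3) (relGammaThree R)
            (Φ F R (QuotientAddGroup.mk t)).toMul =
          SubQuot.incl (R ⊔ gammaThree F) (relGammaThree R) (commOmegaOne R t).toMul) ∧
      (∀ (F₁ F₂ : Type u) [Group F₁] [IsFreeGroup F₁] [Group F₂] [IsFreeGroup F₂]
        (R₁ : Subgroup F₁) [R₁.Normal] (R₂ : Subgroup F₂) [R₂.Normal] (φ : F₁ →* F₂)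
        (h : R₁ ≤ (derivedSup R₂).comap φ) (t : ExtTorSquare (AbQuot R₁)),
        (Φ F₂ R₂ (ExtTorSquare.map (AbQuot.map R₁ R₂ φ h) t)).toMul =
          RelDimQuot.map R₁ R₂ φ h (Φ F₁ R₁ t).toMul) := by
  refine ⟨fun F _ _ R _ => extTorSquareEquiv R, fun F _ _ R _ t =>
    relDimIncl_extTorSquareEquiv t, fun F₁ F₂ _ _ _ _ R₁ _ R₂ _ φ h t => ?_⟩
  induction t using QuotientAddGroup.induction_on with | H t => ?_
  -- Naturality is checked inside $F_2/R_2'\gamma_3(F_2)$, where the isomorphism becomes the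
  -- explicit map `torComm`.
  apply relDimIncl_injective
  refine (relDimIncl_extTorSquareEquiv _).trans ((torComm_map R₂ φ h t).trans ?_)
  rw [← relDimIncl_extTorSquareEquiv]
  generalize extTorSquareEquiv R₁ (QuotientAddGroup.mk t) = z
  induction z using Additive.rec with | ofMul z => ?_
  induction z using QuotientGroup.induction_on with | H z => ?_
  rfl
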